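/- Let $\Omega\subset\mathbb R^2$ be a bounded open set with Lipschitz boundary, let $dS$ be arc length on $\partial\Omega$, and let $O_1,\dots,O_L\subset\partial\Omega$ be measurable with $|O_l|=\int_{O_l}dS>0$. Write $\mathbb H=H^1(\Omega)\oplus\mathbb R^L$ and, for $(u,U)\in\mathbb H$ (boundary values of $u$ being understood as traces), $$\|(u,U)\|_*^2=\|u\|_{H^1(\Omega)}^2+\sum_{l=1}^L\int_{O_l}|u-U_l|^2\,dS .$$ Fix constants $0<c_m<c_M$. Let $\mathcal A(\Omega)$ be the set of measurable functions $f:\Omega\to\mathbb R$ with $c_m<f(x)<c_M$ for all $x\in\Omega$ for which there are finitely many pairwise disjoint open sets $\Omega_1,\dots,\Omega_N\subset\Omega$ with $\overline\Omega=\bigcup_{i=1}^N\overline{\Omega_i}$ such that $f$ is constant on each $\Omega_i$. For $a,b\in\mathcal A(\Omega)$ put $$B((u,U),(w,W);a,b)=\int_\Omega a\,\nabla u\cdot\nabla w\,dx+\int_\Omega b\,u\,w\,dx+\frac12\sum_{l=1}^L\int_{O_l}(u-U_l)(w-W_l)\,dS .$$ Fix a flux pattern $F=(F_l)_{l=1}^L\in\mathbb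 R^L$. Then: (i) for all $a,b\in\mathcal A(\Omega)$ there is a unique $\mathcal M(a,b)=(u,U)\in\mathbb H$ such that $B((u,U),(v,V);a,b)=-\sum_{l=1}^L F_lV_l$ for all $(v,V)\in\mathbb H$, so that the solution operator $\mathcal M:\mathcal A(\Omega)\times\mathcal A(\Omega)\to\mathbb H$ is well defined; (ii) if $a,b\in\mathcal A(\Omega)$ and $(a_\varepsilon),(b_\varepsilon)$ are sequences in $\mathcal A(\Omega)$ with $a_\varepsilon\to a$ and $b_\varepsilon\to b$ in (Lebesgue) measure on $\Omega$, then $$\|\mathcal M(a_\varepsilon,b_\varepsilon)-\mathcal M(a,b)\|_*\to0,$$ and, with the projection $\Pi:\mathbb H\to\mathbb R^L$, $\Pi(v,V)=V$, $$\|\Pi\mathcal M(a_\varepsilon,b_\varepsilon)-\Pi\mathcal M(a,b)\|_{\ell^2}\to0 .$$ -/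

import Mathlib

open MeasureTheory Filter Topology
open scoped ContDiff RealInnerProductSpace

namespace RobinElectrode

/-- The Euclidean plane. -/
abbrev Plane : Type := EuclideanSpace ℝ (Fin 2)

/-- Lebesgue measure on the region `Ω`. -/
noncomputable abbrev vol (Ω : Set Plane) : Measure Plane :=
  (volume : Measure Plane).restrict Ω

/-- Surface measure (arc length) on the boundary of `Ω`: one-dimensional Hausdorff measure. -/
noncomputable abbrev surf (Ω : Set Plane) : Measure Plane :=
  (Measure.hausdorffMeasure 1 : Measure Plane).restrict (frontier Ω)

/-- `Ω` has Lipschitz boundary: near each boundary point, in suitable orthonormal coordinates,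
`Ω` is the part of the plane strictly above the graph of a Lipschitz function. -/
def HasLipschitzBoundary (Ω : Set Plane) : Prop :=
  ∀ x ∈ frontier Ω, ∃ (R : Plane ≃ₗᵢ[ℝ] Plane) (K : NNReal) (γ : ℝ → ℝ) (r : ℝ),
    LipschitzWith K γ ∧ 0 < r ∧ ∀ y ∈ Metric.ball x r, (y ∈ Ω ↔ γ (R y 0) < R y 1)

/-- `G` is the weak gradient of `u` on `Ω`. -/
def IsWeakGradient (Ω : Set Plane) (u : Plane → ℝ) (G : Plane → Plane) : Prop :=
  ∀ φ : Plane → ℝ, ContDiff ℝ ∞ φ → HasCompactSupport φ → tsupport φ ⊆ Ω →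
    ∀ e : Plane, ∫ x in Ω, u x * fderiv ℝ φ x e = -∫ x in Ω, ⟪G x, e⟫ * φ x

theorem integrable_mul_fderiv {Ω : Set Plane} {φ : Plane → ℝ} (hφ : ContDiff ℝ ∞ φ)
    (hc : HasCompactSupport φ) (e : Plane) (u : Lp ℝ 2 (vol Ω)) :
    Integrable (fun x => u x * fderiv ℝ φ x e) (vol Ω) := by
  have h1 : Continuous (fun x => fderiv ℝ φ x e) :=
    (hφ.continuous_fderiv (by simp)).clm_apply continuous_const
  have h2 : HasCompactSupport (fun x => fderiv ℝ φ x e) := hc.fderiv_apply (𝕜 := ℝ) e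
  exact (Lp.memLp u).integrable_mul (q := 2) (h1.memLp_of_hasCompactSupport h2)

theorem integrable_inner_mul {Ω : Set Plane} {φ : Plane → ℝ} (hφ : ContDiff ℝ ∞ φ)
    (hc : HasCompactSupport φ) (e : Plane) (G : Lp Plane 2 (vol Ω)) :
    Integrable (fun x => ⟪G x, e⟫ * φ x) (vol Ω) :=
  ((Lp.memLp G).inner_const e).integrable_mul (q := 2) (hφ.continuous.memLp_of_hasCompactSupport hc)

/-- The Sobolev space `H¹(Ω)`, whose elements are the pairs `(u, ∇u)` with `u ∈ L²(Ω)` and weak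
gradient `∇u ∈ L²(Ω; ℝ²)` (a weak gradient is determined by `u`). The inherited norm is
`‖u‖² = ‖u‖²_{L²} + ‖∇u‖²_{L²}`. -/
noncomputable def H1 (Ω : Set Plane) :
    Submodule ℝ (WithLp 2 (Lp ℝ 2 (vol Ω) × Lp Plane 2 (vol Ω))) where
  carrier := {p | IsWeakGradient Ω p.fst p.snd}
  zero_mem' := by
    intro φ _ _ _ e
    have h1 : ∫ x in Ω, (0 : Lp ℝ 2 (vol Ω)) x * fderiv ℝ φ x e = 0 := by
      refine (integral_congr_ae ?_).trans (integral_zero Plane ℝ)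
      filter_upwards [Lp.coeFn_zero ℝ 2 (vol Ω)] with x hx
      rw [hx, Pi.zero_apply, zero_mul]
    have h2 : ∫ x in Ω, ⟪(0 : Lp Plane 2 (vol Ω)) x, e⟫ * φ x = 0 := by
      refine (integral_congr_ae ?_).trans (integral_zero Plane ℝ)
      filter_upwards [Lp.coeFn_zero Plane 2 (vol Ω)] with x hx
      rw [hx, Pi.zero_apply, inner_zero_left, zero_mul]
    exact h1.trans (by rw [← neg_zero, ← h2]; rfl)
  add_mem' := by
    intro p q hp hq φ h1 h2 h3 e
    have e1 : ∫ x in Ω, (p.fst + q.fst) x * fderiv ℝ φ x e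
        = ∫ x in Ω, (p.fst x * fderiv ℝ φ x e + q.fst x * fderiv ℝ φ x e) := by
      refine integral_congr_ae ?_
      filter_upwards [Lp.coeFn_add p.fst q.fst] with x hx
      rw [hx, Pi.add_apply, add_mul]
    have e2 : ∫ x in Ω, ⟪(p.snd + q.snd) x, e⟫ * φ x
        = ∫ x in Ω, (⟪p.snd x, e⟫ * φ x + ⟪q.snd x, e⟫ * φ x) := by
      refine integral_congr_ae ?_
      filter_upwards [Lp.coeFn_add p.snd q.snd] with x hx
      rw [hx, Pi.add_apply, inner_add_left, add_mul]
    rw [integral_add (integrable_mul_fderiv h1 h2 e _) (integrable_mul_fderiv h1 h2 e _)] at e1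
    rw [integral_add (integrable_inner_mul h1 h2 e _) (integrable_inner_mul h1 h2 e _)] at e2
    have := hp φ h1 h2 h3 e
    have := hq φ h1 h2 h3 e
    refine e1.trans (Eq.trans ?_ (congrArg Neg.neg e2.symm))
    linarith
  smul_mem' := by
    intro c p hp φ h1 h2 h3 e
    have e1 : ∫ x in Ω, (c • p.fst) x * fderiv ℝ φ x e
        = ∫ x in Ω, c * (p.fst x * fderiv ℝ φ x e) := by
      refine integral_congr_ae ?_
      filter_upwards [Lp.coeFn_smul c p.fst] with x hx
      rw [hx, Pi.smul_apply, smul_eq_mul, mul_assoc]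
    have e2 : ∫ x in Ω, ⟪(c • p.snd) x, e⟫ * φ x = ∫ x in Ω, c * (⟪p.snd x, e⟫ * φ x) := by
      refine integral_congr_ae ?_
      filter_upwards [Lp.coeFn_smul c p.snd] with x hx
      rw [hx, Pi.smul_apply, real_inner_smul_left, mul_assoc]
    rw [integral_const_mul] at e1 e2
    refine e1.trans (Eq.trans ?_ (congrArg Neg.neg e2.symm))
    rw [hp φ h1 h2 h3 e]
    ring

/-- The function `u ∈ L²(Ω)` underlying an element of `H¹(Ω)`. -/
noncomputable def fn {Ω : Set Plane} (u : H1 Ω) : Lp ℝ 2 (vol Ω) :=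
  (u : WithLp 2 (Lp ℝ 2 (vol Ω) × Lp Plane 2 (vol Ω))).fst

/-- The weak gradient of an element of `H¹(Ω)`. -/
noncomputable def wgrad {Ω : Set Plane} (u : H1 Ω) : Lp Plane 2 (vol Ω) :=
  (u : WithLp 2 (Lp ℝ 2 (vol Ω) × Lp Plane 2 (vol Ω))).snd

/-- `g ∈ L²(∂Ω)` is the boundary trace of `u ∈ H¹(Ω)`: some functions that are smooth up to the
boundary converge to `u` in `H¹(Ω)` while their boundary values converge to `g` in `L²(∂Ω)`. -/
def IsTrace {Ω : Set Plane} (u : H1 Ω) (g : Lp ℝ 2 (surf Ω)) : Prop :=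
  ∃ φ : ℕ → Plane → ℝ, (∀ n, ContDiff ℝ ∞ (φ n)) ∧
    Tendsto (fun n => eLpNorm (fun x => φ n x - fn u x) 2 (vol Ω)) atTop (𝓝 0) ∧
    Tendsto (fun n => eLpNorm (fun x => gradient (φ n) x - wgrad u x) 2 (vol Ω)) atTop (𝓝 0) ∧
    Tendsto (fun n => eLpNorm (fun x => φ n x - g x) 2 (surf Ω)) atTop (𝓝 0)

open Classical in
/-- The trace operator `H¹(Ω) → L²(∂Ω)`. -/
noncomputable def trace {Ω : Set Plane} (u : H1 Ω) : Lp ℝ 2 (surf Ω) :=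
  if h : ∃ g, IsTrace u g then h.choose else 0

/-- The solution space `H¹(Ω) ⊕ ℝ^L` (only its vector space structure is used;
the norm that is put on it is `starNorm`). -/
abbrev SolSpace (Ω : Set Plane) (L : ℕ) : Type := H1 Ω × EuclideanSpace ℝ (Fin L)

/-- `‖(u,U)‖_*² = ‖u‖²_{H¹} + ∑ₗ ∫_{Oₗ} |u - Uₗ|² dS`. -/
noncomputable def starNorm {Ω : Set Plane} {L : ℕ} (O : Fin L → Set Plane)
    (p : SolSpace Ω L) : ℝ :=
  Real.sqrt (‖p.1‖ ^ 2 + ∑ l, ∫ x in O l, |trace p.1 x - p.2 l| ^ 2 ∂(surf Ω))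

/-- The bilinear form
`B((u,U),(w,W)) = ∫ a ∇u·∇w + ∫ b u w + ∑ₗ ½ ∫_{Oₗ} (u - Uₗ)(w - Wₗ) dS`. -/
noncomputable def bilin {Ω : Set Plane} {L : ℕ} (O : Fin L → Set Plane)
    (a b : Plane → ℝ) (p q : SolSpace Ω L) : ℝ :=
  (∫ x in Ω, a x * ⟪wgrad p.1 x, wgrad q.1 x⟫) + (∫ x in Ω, b x * fn p.1 x * fn q.1 x)
    + ∑ l, (1 / 2 : ℝ) *
        ∫ x in O l, (trace p.1 x - p.2 l) * (trace q.1 x - q.2 l) ∂(surf Ω)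

/-- `(u,U)` is a weak solution for the coefficients `a`, `b` and the flux pattern `F`. -/
def IsWeakSolution {Ω : Set Plane} {L : ℕ} (O : Fin L → Set Plane) (F : Fin L → ℝ)
    (a b : Plane → ℝ) (p : SolSpace Ω L) : Prop :=
  ∀ q : SolSpace Ω L, bilin O a b p q = -∑ l, F l * q.2 l

/-- The solution operator `M : (a,b) ↦ (u,U)`. -/
noncomputable def solutionOperator (Ω : Set Plane) {L : ℕ} (O : Fin L → Set Plane)
    (F : Fin L → ℝ) (a b : Plane → ℝ) : SolSpace Ω L :=
  Classical.epsilon (IsWeakSolution O F a b)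

/-- The projection `Π(v,V) = V`. -/
def voltages {Ω : Set Plane} {L : ℕ} (p : SolSpace Ω L) : EuclideanSpace ℝ (Fin L) := p.2

/-- The admissible class of coefficients with bounds `cm < cM`: (measurable) functions on `Ω` that
are constant on each of finitely many disjoint open subsets of `Ω` whose closures cover
the closure of `Ω`, and whose values lie strictly between `cm` and `cM`.
Values outside `Ω` are irrelevant. -/
def Admissible (Ω : Set Plane) (cm cM : ℝ) : Set (Plane → ℝ) :=
  {f | AEStronglyMeasurable f (vol Ω) ∧
    (∃ (N : ℕ) (D : Fin N → Set Plane) (c : Fin N → ℝ),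
      (∀ i, IsOpen (D i) ∧ D i ⊆ Ω) ∧ Pairwise (fun i j => Disjoint (D i) (D j)) ∧
      closure Ω = ⋃ i, closure (D i) ∧ ∀ i, ∀ x ∈ D i, f x = c i) ∧
    ∀ x ∈ Ω, cm < f x ∧ f x < cM}

end RobinElectrode

/-!
The solution operator is well defined and continuous because the form `bilin` is bounded and
coercive for the norm `starNorm`, uniformly over the admissible coefficients.

*Well-posedness.* Coercivity with constant `min cm (1 / 2)` is immediate from the definitions
(`min_mul_starNorm_sq_le_bilin`). To apply the Lax–Milgram theorem on the Hilbert space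
`H¹(Ω) ⊕ ℝ^L`, one needs that `starNorm` dominates its norm (`exists_norm_le_starNorm`; this is
where `|Oₗ| > 0` enters) and that `bilin` is a bounded bilinear form (`exists_bilinL`). Both rest on
the trace theorem `exists_traceCLM`: on a bounded Lipschitz domain, `trace` is a bounded linear
operator `H¹(Ω) → L²(∂Ω)`.

*The trace theorem* has two halves. Functions smooth up to the boundary are dense in `H¹(Ω)`
(`exists_smooth_approx`): a Lipschitz domain has the interior cone property
(`exists_interior_cone`), so that locally `u` can be mollified with kernels which look only into
`Ω`; such mollifications commute with the weak gradient (`gradient_convolution`) and converge in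
`L²` (`eLpNorm_convolution_sub_le`), and a partition of unity glues them together. And for smooth
functions the `L²(∂Ω)` norm is bounded by the `H¹(Ω)` norm (`hasTraceInequality_frontier`): in graph
coordinates this is a one-dimensional inequality on vertical segments (`enorm_sq_endpoint_le`),
integrated over the base. So the trace exists for every `u`, as a limit, and is unique.

*Continuity.* Let `p = (u, U)` and `p'` be the solutions for `(a, b)` and `(a', b')`. Testing the
equation for `p' - p` with `p' - p` itself gives (`starNorm_sub_le`)
`min cm (1 / 2) * starNorm (p' - p) ≤ ‖(a - a') ∇u‖ + ‖(b - b') u‖`,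
with `L²` norms on the right. Only the fixed functions `u` and `∇u` appear there, so for bounded
coefficients converging in measure the right-hand side tends to zero by dominated convergence along
subsequences (`tendsto_eLpNorm_sub_smul_of_tendstoInMeasure`).
-/

namespace RobinElectrode

open scoped ENNReal Convolution

/-! ### Mollification in `L²` -/

section Mollify

variable {E : Type*} [NormedAddCommGroup E]

/-- Continuity of translation in `L²`. -/
theorem tendsto_eLpNorm_translate_sub {f : Plane → E} (hf : MemLp f 2 volume) :
    Tendsto (fun s : Plane => eLpNorm (fun y => f (y - s) - f y) 2 volume) (𝓝 0) (𝓝 0) := by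
  have : Fact ((2 : ℝ≥0∞) ≠ ⊤) := ⟨by norm_num⟩
  have hc : Continuous (fun s : Plane => DomAddAct.mk (-s) +ᵥ hf.toLp f) :=
    ((DomAddAct.continuous_mk (M := Plane)).comp continuous_neg).vadd continuous_const
  have h0 := hc.tendsto 0
  rw [tendsto_iff_edist_tendsto_0] at h0
  refine h0.congr fun s => ?_
  rw [DomAddAct.mk_vadd_toLp, DomAddAct.mk_vadd_toLp, Lp.edist_toLp_toLp]
  simp [Pi.sub_def, neg_add_eq_sub]

/-- Averaging the translates of `f` against a probability measure moves `f` in `L²` by at most the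
largest of the distances from `f` to those translates. -/
theorem eLpNorm_average_translate_sub_le [NormedSpace ℝ E] [CompleteSpace E]
    {f : Plane → E} (hf : StronglyMeasurable f) (ν : Measure Plane) [IsProbabilityMeasure ν]
    (hint : ∀ y, Integrable (fun s => f (y - s)) ν) {η : ℝ≥0∞}
    (h : ∀ᵐ s ∂ν, eLpNorm (fun y => f (y - s) - f y) 2 volume ≤ η) :
    eLpNorm (fun y => (∫ s, f (y - s) ∂ν) - f y) 2 volume ≤ η := by
  have key : ∀ {g : Plane → E} {μ : Measure Plane},
      eLpNorm g 2 μ ^ 2 = ∫⁻ x, ‖g x‖ₑ ^ 2 ∂μ := by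
    intro g μ
    have := eLpNorm_nnreal_pow_eq_lintegral (f := g) (μ := μ) (p := 2) (by norm_num)
    simpa using this
  have hpt : ∀ y, ‖(∫ s, f (y - s) ∂ν) - f y‖ₑ ^ 2 ≤ ∫⁻ s, ‖f (y - s) - f y‖ₑ ^ 2 ∂ν := by
    intro y
    have e : (∫ s, f (y - s) ∂ν) - f y = ∫ s, (f (y - s) - f y) ∂ν := by
      rw [integral_sub (hint y) (integrable_const _)]; simp
    rw [e, ← key]
    gcongr
    refine (enorm_integral_le_lintegral_enorm _).trans ?_
    rw [← eLpNorm_one_eq_lintegral_enorm]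
    exact eLpNorm_le_eLpNorm_of_exponent_le (by norm_num)
      ((hint y).sub (integrable_const _)).aestronglyMeasurable
  rw [← ENNReal.pow_le_pow_left_iff (n := 2) (by norm_num), key]
  calc ∫⁻ y, ‖(∫ s, f (y - s) ∂ν) - f y‖ₑ ^ 2
      ≤ ∫⁻ y, ∫⁻ s, ‖f (y - s) - f y‖ₑ ^ 2 ∂ν := lintegral_mono hpt
    _ = ∫⁻ s, ∫⁻ y, ‖f (y - s) - f y‖ₑ ^ 2 ∂volume ∂ν := by
        refine lintegral_lintegral_swap ?_
        refine Measurable.aemeasurable ?_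
        have h1 : StronglyMeasurable (fun p : Plane × Plane => f (p.1 - p.2) - f p.1) :=
          (hf.comp_measurable (measurable_fst.sub measurable_snd)).sub
            (hf.comp_measurable measurable_fst)
        exact h1.enorm.pow_const 2
    _ = ∫⁻ s, eLpNorm (fun y => f (y - s) - f y) 2 volume ^ 2 ∂ν := by simp only [key]
    _ ≤ ∫⁻ s, η ^ 2 ∂ν := lintegral_mono_ae (h.mono fun s hs => by gcongr)
    _ = η ^ 2 := by simp

/-- Convolution with a nonnegative compactly supported kernel of mass one, `K ⋆ f`, stays
`η`-close to `f` in `L²` as soon as all translations by the support of `K` do. -/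
theorem eLpNorm_convolution_sub_le [NormedSpace ℝ E] [CompleteSpace E] {f : Plane → E}
    (hf : StronglyMeasurable f) (hf2 : MemLp f 2 volume) {K : Plane → ℝ}
    (hKc : Continuous K) (hKs : HasCompactSupport K) (hK0 : ∀ s, 0 ≤ K s) (hK1 : ∫ s, K s = 1) {η : ℝ≥0∞}
    (h : ∀ s, K s ≠ 0 → eLpNorm (fun y => f (y - s) - f y) 2 volume ≤ η) :
    eLpNorm (fun y => (K ⋆[ContinuousLinearMap.lsmul ℝ ℝ, volume] f) y - f y) 2 volume ≤ η := by
  set ν : Measure Plane := volume.withDensity (fun s => ENNReal.ofReal (K s)) with hν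
  have hKi : Integrable K := hKc.integrable_of_hasCompactSupport hKs
  have hm : Measurable (fun s => ENNReal.ofReal (K s)) := hKc.measurable.ennreal_ofReal
  have : IsProbabilityMeasure ν := ⟨by
    rw [hν, withDensity_apply _ MeasurableSet.univ, Measure.restrict_univ,
      ← ofReal_integral_eq_lintegral_ofReal hKi (ae_of_all _ hK0), hK1, ENNReal.ofReal_one]⟩
  have hfin : ∀ᵐ s : Plane, ENNReal.ofReal (K s) < ⊤ := ae_of_all _ fun s => ENNReal.ofReal_lt_top
  have hloc : LocallyIntegrable f volume := hf2.locallyIntegrable (by norm_num)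
  have hint : ∀ y, Integrable (fun s => f (y - s)) ν := by
    intro y
    rw [hν, integrable_withDensity_iff_integrable_smul' hm hfin]
    have := hKs.convolutionExists_left (L := ContinuousLinearMap.lsmul ℝ ℝ) hKc hloc y
    simpa [ConvolutionExistsAt, ENNReal.toReal_ofReal, hK0] using this
  have e : ∀ y, (K ⋆[ContinuousLinearMap.lsmul ℝ ℝ, volume] f) y = ∫ s, f (y - s) ∂ν := by
    intro y
    rw [hν, integral_withDensity_eq_integral_toReal_smul hm hfin, convolution_lsmul]
    simp [ENNReal.toReal_ofReal, hK0]
  simp_rw [e]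
  refine eLpNorm_average_translate_sub_le hf ν hint ?_
  rw [hν, ae_withDensity_iff hm]
  refine ae_of_all _ fun s hs => h s fun h0 => hs (by simp [h0])

end Mollify

/-! ### Inward mollification of Sobolev functions -/

/-- A Lipschitz domain has the uniform interior cone property, locally around every point of its
closure: the balls of radius `ε` around `y + ε d` lie in `Ω`. -/
theorem exists_interior_cone {Ω : Set Plane} (hopen : IsOpen Ω) (hlip : HasLipschitzBoundary Ω)
    {x : Plane} (hx : x ∈ closure Ω) :
    ∃ (r : ℝ) (d : Plane) (ε₀ : ℝ), 0 < r ∧ 0 < ε₀ ∧ ∀ ε, 0 < ε → ε < ε₀ →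
      ∀ y ∈ Ω ∩ Metric.ball x r, Metric.closedBall (y + ε • d) ε ⊆ Ω := by
  by_cases hxΩ : x ∈ Ω
  · obtain ⟨r, hr, hrΩ⟩ := Metric.isOpen_iff.1 hopen x hxΩ
    refine ⟨r / 2, 0, r / 2, by positivity, by positivity, fun ε h0 h1 y hy z hz => hrΩ ?_⟩
    have h2 := hy.2
    rw [smul_zero, add_zero] at hz
    rw [Metric.mem_closedBall] at hz
    rw [Metric.mem_ball] at h2 ⊢
    linarith [dist_triangle z y x]
  · have hxf : x ∈ frontier Ω := ⟨hx, by rwa [hopen.interior_eq]⟩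
    obtain ⟨R, K, γ, r, hγ, hr, hΩ⟩ := hlip x hxf
    -- In the coordinates of the graph the cone opens upwards; it has to be steeper than the graph.
    set d : Plane := R.symm (((K : ℝ) + 2) • EuclideanSpace.single 1 1) with hd
    have hdn : ‖d‖ = K + 2 := by
      rw [hd, LinearIsometryEquiv.norm_map, norm_smul]
      simp [abs_of_nonneg (by positivity : (0 : ℝ) ≤ K + 2)]
    have hK : (0 : ℝ) ≤ K := K.2
    refine ⟨r / 2, d, r / 2 / (K + 3), by positivity, by positivity,
      fun ε h0 h1 y hy z hz => ?_⟩
    rw [lt_div_iff₀ (by positivity)] at h1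
    rw [Metric.mem_closedBall] at hz
    have h2 := hy.2
    rw [Metric.mem_ball] at h2
    have hzy : dist (y + ε • d) y = ε * (K + 2) := by
      rw [dist_eq_norm, add_sub_cancel_left, norm_smul, hdn, Real.norm_of_nonneg h0.le]
    have hzb : z ∈ Metric.ball x r := by
      rw [Metric.mem_ball]
      have := dist_triangle z (y + ε • d) x
      have := dist_triangle (y + ε • d) y x
      linarith
    have hyb : y ∈ Metric.ball x r := by rw [Metric.mem_ball]; linarith
    rw [hΩ z hzb]
    have hyΩ := (hΩ y hyb).1 hy.1
    set w : Plane := z - (y + ε • d) with hw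
    have hwn : ‖R w‖ ≤ ε := by rwa [LinearIsometryEquiv.norm_map, hw, ← dist_eq_norm]
    have hzw : R z = R y + (ε * (K + 2)) • EuclideanSpace.single 1 1 + R w := by
      have : z = y + ε • d + w := by rw [hw]; abel
      rw [this, map_add, map_add, map_smul, hd, LinearIsometryEquiv.apply_symm_apply, smul_smul]
    have e0 : R z 0 = R y 0 + R w 0 := by rw [hzw]; simp
    have e1 : R z 1 = R y 1 + ε * (K + 2) + R w 1 := by rw [hzw]; simp
    have w0 : |R w 0| ≤ ε := (PiLp.norm_apply_le (R w) 0).trans hwn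
    have w1 : |R w 1| ≤ ε := (PiLp.norm_apply_le (R w) 1).trans hwn
    have hL := hγ.dist_le_mul (R z 0) (R y 0)
    rw [Real.dist_eq, Real.dist_eq, e0, add_sub_cancel_left] at hL
    have h3 : (K : ℝ) * |R w 0| ≤ K * ε := by gcongr
    rw [e1, e0]
    linarith [le_abs_self (γ (R y 0 + R w 0) - γ (R y 0)), neg_abs_le (R w 1)]

/-- Mollification commutes with the weak gradient at points `y` where the translated kernel
`K (y - ·)` is supported inside `Ω`. -/
theorem gradient_convolution {Ω : Set Plane} (hΩ : MeasurableSet Ω) (u : H1 Ω) {K : Plane → ℝ}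
    (hK : ContDiff ℝ ∞ K) (hKs : HasCompactSupport K) {y : Plane}
    (hy : ∀ s ∈ tsupport K, y - s ∈ Ω) :
    gradient (K ⋆[ContinuousLinearMap.lsmul ℝ ℝ, volume] (Ω.indicator (fn u))) y =
      (K ⋆[ContinuousLinearMap.lsmul ℝ ℝ, volume] (Ω.indicator (wgrad u))) y := by
  have hlu : LocallyIntegrable (Ω.indicator (fn u)) volume :=
    ((memLp_indicator_iff_restrict hΩ).2 (Lp.memLp (fn u))).locallyIntegrable (by norm_num)
  have hlg : LocallyIntegrable (Ω.indicator (wgrad u)) volume :=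
    ((memLp_indicator_iff_restrict hΩ).2 (Lp.memLp (wgrad u))).locallyIntegrable (by norm_num)
  refine ext_inner_right ℝ fun e => ?_
  rw [inner_gradient_left, (hKs.hasFDerivAt_convolution_left (ContinuousLinearMap.lsmul ℝ ℝ)
    (hK.of_le (by simp)) hlu y).fderiv]
  have hDe : ((fderiv ℝ K ⋆[(ContinuousLinearMap.lsmul ℝ ℝ).precompL Plane, volume]
      (Ω.indicator (fn u))) y) e = ∫ z, fderiv ℝ K (y - z) e * Ω.indicator (fn u) z := by
    rw [convolution_eq_swap]
    have hi := (hKs.fderiv ℝ).convolutionExists_left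
      (L := (ContinuousLinearMap.lsmul ℝ ℝ : ℝ →L[ℝ] ℝ →L[ℝ] ℝ).precompL Plane)
      (hK.continuous_fderiv (by simp)) hlu y
    have := ContinuousLinearMap.integral_apply hi.integrable_swap e
    rw [this]
    simp [ContinuousLinearMap.precompL_apply]
  have hG : ⟪(K ⋆[ContinuousLinearMap.lsmul ℝ ℝ, volume] (Ω.indicator (wgrad u))) y, e⟫
      = ∫ z, K (y - z) * ⟪Ω.indicator (wgrad u) z, e⟫ := by
    rw [convolution_eq_swap, real_inner_comm]
    have hi := hKs.convolutionExists_left (L := ContinuousLinearMap.lsmul ℝ ℝ)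
      hK.continuous hlg y
    rw [← integral_inner hi.integrable_swap]
    simp [real_inner_smul_right, real_inner_comm]
  have hψ : ContDiff ℝ ∞ (fun z => K (y - z)) := hK.comp (contDiff_const.sub contDiff_id)
  have hψt : tsupport (fun z => K (y - z)) = (fun z => y - z) ⁻¹' tsupport K :=
    tsupport_comp_eq_preimage K (Homeomorph.subLeft y)
  have hψc : HasCompactSupport (fun z => K (y - z)) := hKs.comp_homeomorph (Homeomorph.subLeft y)
  have hw : IsWeakGradient Ω (fn u) (wgrad u) := u.2
  have hw := hw _ hψ hψc (by
    rw [hψt]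
    intro z hz
    simpa using hy _ hz) e
  have hd : ∀ z, fderiv ℝ (fun z => K (y - z)) z e = - fderiv ℝ K (y - z) e := by
    intro z
    have h1 : HasFDerivAt (fun z => K (y - z)) ((fderiv ℝ K (y - z)).comp
        (-(ContinuousLinearMap.id ℝ Plane))) z := by
      refine HasFDerivAt.comp z ?_ ?_
      · exact (hK.differentiable (by simp) _).hasFDerivAt
      · exact (hasFDerivAt_id z).const_sub y
    rw [h1.fderiv]; simp
  rw [hDe, hG]
  have e1 : ∀ z, fderiv ℝ K (y - z) e * Ω.indicator (fn u) z
      = Ω.indicator (fun z => fderiv ℝ K (y - z) e * fn u z) z := by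
    intro z; by_cases hz : z ∈ Ω <;> simp [hz]
  have e2 : ∀ z, K (y - z) * ⟪Ω.indicator (wgrad u) z, e⟫
      = Ω.indicator (fun z => ⟪wgrad u z, e⟫ * K (y - z)) z := by
    intro z; by_cases hz : z ∈ Ω <;> simp [hz, mul_comm]
  simp_rw [e1, e2]
  rw [integral_indicator hΩ, integral_indicator hΩ]
  simp_rw [hd, mul_neg, integral_neg] at hw
  rw [← neg_inj, ← hw]
  simp_rw [mul_comm]

/-- Mollifying with kernels centred at `-ε d`, the zero extension of `u ∈ H¹(Ω)` is approximated
by smooth functions; their gradients approximate the weak gradient of `u` near those points `y`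
for which the ball of radius `ε` around `y + ε d` lies in `Ω`. -/
theorem exists_shifted_mollification {Ω : Set Plane} (hΩ : MeasurableSet Ω) (u : H1 Ω) (d : Plane)
    {ε₀ : ℝ} (hε₀ : 0 < ε₀) {η : ℝ≥0∞} (hη : 0 < η) :
    ∃ (ψ : Plane → ℝ) (Ψ : Plane → Plane) (ε : ℝ), ContDiff ℝ ∞ ψ ∧ Continuous Ψ ∧
      0 < ε ∧ ε < ε₀ ∧ eLpNorm (fun x => ψ x - fn u x) 2 (vol Ω) ≤ η ∧
      eLpNorm (fun x => Ψ x - wgrad u x) 2 (vol Ω) ≤ η ∧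
      ∀ y, Metric.closedBall (y + ε • d) ε ⊆ Ω → gradient ψ y = Ψ y := by
  have hu := (memLp_indicator_iff_restrict hΩ).2 (Lp.memLp (fn u))
  have hg := (memLp_indicator_iff_restrict hΩ).2 (Lp.memLp (wgrad u))
  have hev := ((tendsto_eLpNorm_translate_sub hu).eventually (Iic_mem_nhds hη)).and
    ((tendsto_eLpNorm_translate_sub hg).eventually (Iic_mem_nhds hη))
  obtain ⟨δ, hδ, hδs⟩ := Metric.eventually_nhds_iff.1 hev
  obtain ⟨ε, hε, hε1⟩ : ∃ ε, 0 < ε ∧ ε < min ε₀ (δ / (1 + ‖d‖)) :=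
    exists_between (lt_min hε₀ (by positivity))
  have hεδ : ε * (1 + ‖d‖) < δ := by
    have := hε1.trans_le (min_le_right _ _)
    rwa [lt_div_iff₀ (by positivity)] at this
  let B : ContDiffBump (0 : Plane) := ⟨ε / 2, ε, by positivity, by linarith⟩
  let K : Plane → ℝ := fun s => B.normed volume (s + ε • d)
  have hK : ContDiff ℝ ∞ K := B.contDiff_normed.comp (contDiff_id.add contDiff_const)
  have hKt : tsupport K = (fun s => s + ε • d) ⁻¹' Metric.closedBall 0 ε := by
    have := tsupport_comp_eq_preimage (B.normed volume) (Homeomorph.addRight (ε • d))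
    rw [B.tsupport_normed_eq] at this
    exact this
  have hKs : HasCompactSupport K :=
    B.hasCompactSupport_normed.comp_homeomorph (Homeomorph.addRight (ε • d))
  have hK1 : ∫ s, K s = 1 := by
    rw [← B.integral_normed (μ := volume)]
    exact integral_add_right_eq_self (μ := volume) (B.normed volume) (ε • d)
  have hsmall : ∀ s, K s ≠ 0 → dist s 0 < δ := by
    intro s hs
    have h1 : s ∈ tsupport K := subset_tsupport _ hs
    rw [hKt, Set.mem_preimage, mem_closedBall_zero_iff] at h1
    rw [dist_zero_right]
    calc ‖s‖ = ‖(s + ε • d) - ε • d‖ := by rw [add_sub_cancel_right]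
      _ ≤ ‖s + ε • d‖ + ‖ε • d‖ := norm_sub_le _ _
      _ ≤ ε + ε * ‖d‖ := by rw [norm_smul, Real.norm_of_nonneg hε.le]; gcongr
      _ < δ := by linarith
  have hc1 := eLpNorm_convolution_sub_le ((Lp.stronglyMeasurable (fn u)).indicator hΩ) hu
    hK.continuous hKs (fun s => B.nonneg_normed _) hK1 (fun s hs => (hδs (hsmall s hs)).1)
  have hc2 := eLpNorm_convolution_sub_le ((Lp.stronglyMeasurable (wgrad u)).indicator hΩ) hg
    hK.continuous hKs (fun s => B.nonneg_normed _) hK1 (fun s hs => (hδs (hsmall s hs)).2)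
  refine ⟨K ⋆[ContinuousLinearMap.lsmul ℝ ℝ, volume] (Ω.indicator (fn u)),
    K ⋆[ContinuousLinearMap.lsmul ℝ ℝ, volume] (Ω.indicator (wgrad u)), ε,
    hKs.contDiff_convolution_left _ hK (hu.locallyIntegrable (by norm_num)),
    hKs.continuous_convolution_left _ hK.continuous (hg.locallyIntegrable (by norm_num)),
    hε, hε1.trans_le (min_le_left _ _), ?_, ?_, ?_⟩
  · refine le_trans (le_of_eq ?_)
      ((eLpNorm_mono_measure _ (Measure.restrict_le_self (s := Ω))).trans hc1)
    refine eLpNorm_congr_ae ?_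
    filter_upwards [ae_restrict_mem hΩ] with x hx
    simp [hx]
  · refine le_trans (le_of_eq ?_)
      ((eLpNorm_mono_measure _ (Measure.restrict_le_self (s := Ω))).trans hc2)
    refine eLpNorm_congr_ae ?_
    filter_upwards [ae_restrict_mem hΩ] with x hx
    simp [hx]
  · intro y hy
    refine gradient_convolution hΩ u hK hKs fun s hs => hy ?_
    rw [hKt, Set.mem_preimage, mem_closedBall_zero_iff] at hs
    rw [mem_closedBall_iff_norm, ← norm_neg]
    convert hs using 2
    abel

/-! ### Density of smooth functions in `H¹(Ω)` -/

theorem continuous_gradient {φ : Plane → ℝ} (hφ : ContDiff ℝ ∞ φ) : Continuous (gradient φ) :=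
  (InnerProductSpace.toDual ℝ Plane).symm.continuous.comp (hφ.continuous_fderiv (by simp))

theorem gradient_sum_mul {ι : Type*} [Fintype ι] {χ ψ : ι → Plane → ℝ}
    (hχ : ∀ i, ContDiff ℝ ∞ (χ i)) (hψ : ∀ i, ContDiff ℝ ∞ (ψ i)) (y : Plane) :
    gradient (fun x => ∑ i, χ i x * ψ i x) y
      = ∑ i, (ψ i y • gradient (χ i) y + χ i y • gradient (ψ i) y) := by
  refine ext_inner_right ℝ fun e => ?_
  have hχd : ∀ i, DifferentiableAt ℝ (χ i) y := fun i => (hχ i).differentiable (by simp) y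
  have hψd : ∀ i, DifferentiableAt ℝ (ψ i) y := fun i => (hψ i).differentiable (by simp) y
  rw [inner_gradient_left, fderiv_fun_sum (fun i _ => (hχd i).fun_mul (hψd i)), sum_inner,
    sum_apply]
  refine Finset.sum_congr rfl fun i _ => ?_
  rw [fderiv_fun_mul (hχd i) (hψd i), inner_add_left, real_inner_smul_left, real_inner_smul_left,
    inner_gradient_left, inner_gradient_left]
  simp only [add_apply, smul_apply, smul_eq_mul]
  ring

/-- A smooth partition of unity on a compact set, subordinate to a choice of balls. -/
theorem exists_smooth_partition {s : Set Plane} (hs : IsCompact s) {r : Plane → ℝ}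
    (hr : ∀ x ∈ s, 0 < r x) :
    ∃ (t : Finset Plane) (χ : t → Plane → ℝ), (↑t ⊆ s) ∧ (∀ i, ContDiff ℝ ∞ (χ i)) ∧
      (∀ i y, |χ i y| ≤ 1) ∧ (∃ C, ∀ i y, ‖gradient (χ i) y‖ ≤ C) ∧
      (∀ i y, χ i y ≠ 0 → y ∈ Metric.ball (i : Plane) (r i)) ∧ ∀ y ∈ s, ∑ i, χ i y = 1 := by
  obtain ⟨t, hts, hcov⟩ := hs.elim_nhds_subcover (fun x => Metric.ball x (r x))
    (fun x hx => Metric.ball_mem_nhds x (hr x hx))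
  obtain ⟨ρ, hρ⟩ := SmoothPartitionOfUnity.exists_isSubordinate (modelWithCornersSelf ℝ Plane)
    hs.isClosed (fun i : t => Metric.ball (i : Plane) (r i)) (fun i => Metric.isOpen_ball)
    (fun y hy => by
      obtain ⟨i, hi, hy⟩ := Set.mem_iUnion₂.1 (hcov hy)
      exact Set.mem_iUnion.2 ⟨⟨i, hi⟩, hy⟩)
  have hsm : ∀ i, ContDiff ℝ ∞ (ρ i) := fun i => (ρ i).contMDiff.contDiff
  have hcs : ∀ i, HasCompactSupport (ρ i) := fun i =>
    HasCompactSupport.of_support_subset_isCompact (isCompact_closedBall (i : Plane) (r i))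
      ((subset_tsupport _).trans ((hρ i).trans Metric.ball_subset_closedBall))
  have hb : ∀ i, ∃ C, ∀ y, ‖gradient (ρ i) y‖ ≤ C := by
    intro i
    obtain ⟨C, hC⟩ := ((hcs i).fderiv ℝ).exists_bound_of_continuous
      ((hsm i).continuous_fderiv (by simp))
    exact ⟨C, fun y => by simpa [gradient] using hC y⟩
  choose C hC using hb
  refine ⟨t, fun i => ρ i, fun x hx => hts x hx, hsm, fun i y => ?_, ⟨∑ i, |C i|, fun i y => ?_⟩,
    fun i y hy => hρ i (subset_tsupport _ hy), fun y hy => ?_⟩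
  · rw [abs_of_nonneg (ρ.nonneg i y)]; exact ρ.le_one i y
  · exact (hC i y).trans ((le_abs_self _).trans
      (Finset.single_le_sum (f := fun i => |C i|) (fun i _ => abs_nonneg _) (Finset.mem_univ i)))
  · rw [← finsum_eq_sum_of_fintype]; exact ρ.sum_eq_one hy

/-- Functions that are smooth up to the boundary are dense in `H¹(Ω)`. -/
theorem exists_smooth_approx {Ω : Set Plane} (hopen : IsOpen Ω) (hbdd : Bornology.IsBounded Ω)
    (hlip : HasLipschitzBoundary Ω) (u : H1 Ω) {η : ℝ≥0∞} (hη : 0 < η) :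
    ∃ φ : Plane → ℝ, ContDiff ℝ ∞ φ ∧ eLpNorm (fun x => φ x - fn u x) 2 (vol Ω) ≤ η ∧
      eLpNorm (fun x => gradient φ x - wgrad u x) 2 (vol Ω) ≤ η := by
  choose! r d ε₀ hr hε₀ hcone using fun x (hx : x ∈ closure Ω) =>
    exists_interior_cone hopen hlip hx
  obtain ⟨t, χ, htΩ, hχ, hχ1, ⟨C, hC⟩, hχr, hsum⟩ :=
    exists_smooth_partition hbdd.isCompact_closure hr
  obtain ⟨η', hη', hηle⟩ : ∃ η' : ℝ≥0∞, 0 < η' ∧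
      (Fintype.card t : ℝ≥0∞) * (ENNReal.ofReal C * η' + η') ≤ η := by
    have hA : (Fintype.card t : ℝ≥0∞) * (ENNReal.ofReal C + 1) ≠ ⊤ := by finiteness
    obtain ⟨δ, hδ, hδη⟩ := ENNReal.exists_nnreal_pos_mul_lt hA hη.ne'
    refine ⟨δ, by simpa using hδ, le_trans (le_of_eq ?_) hδη.le⟩
    ring
  -- Glue the mollifications `ψ i` of `u` on the balls of the partition to `∑ χ i * ψ i`.
  choose ψ Ψ ε hψ hΨ hε hεε₀ h1 h2 h3 using fun i : t =>
    exists_shifted_mollification hopen.measurableSet u (d i) (hε₀ i (htΩ i.2)) hη'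
  have hm : ∀ i, AEStronglyMeasurable (fun x => ψ i x - fn u x) (vol Ω) := fun i =>
    (hψ i).continuous.aestronglyMeasurable.sub (Lp.aestronglyMeasurable _)
  have hM : ∀ i, AEStronglyMeasurable (fun x => Ψ i x - wgrad u x) (vol Ω) := fun i =>
    (hΨ i).aestronglyMeasurable.sub (Lp.aestronglyMeasurable _)
  have hχm : ∀ i, AEStronglyMeasurable (χ i) (vol Ω) := fun i =>
    (hχ i).continuous.aestronglyMeasurable
  have hχg : ∀ i, AEStronglyMeasurable (gradient (χ i)) (vol Ω) := fun i =>
    (continuous_gradient (hχ i)).aestronglyMeasurable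
  have b1 : ∀ i, eLpNorm (fun x => χ i x * (ψ i x - fn u x)) 2 (vol Ω) ≤ η' := fun i => by
    refine (eLpNorm_mono fun x => ?_).trans (h1 i)
    rw [norm_mul]
    exact mul_le_of_le_one_left (norm_nonneg _) (hχ1 i x)
  have b2 : ∀ i, eLpNorm (fun x => χ i x • (Ψ i x - wgrad u x)) 2 (vol Ω) ≤ η' := fun i => by
    refine (eLpNorm_mono fun x => ?_).trans (h2 i)
    rw [norm_smul]
    exact mul_le_of_le_one_left (norm_nonneg _) (hχ1 i x)
  have b3 : ∀ i, eLpNorm (fun x => (ψ i x - fn u x) • gradient (χ i) x) 2 (vol Ω)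
      ≤ ENNReal.ofReal C * η' := fun i => by
    refine (eLpNorm_le_mul_eLpNorm_of_ae_le_mul (g := fun x => ψ i x - fn u x)
      (ae_of_all _ fun x => ?_) 2).trans (by gcongr; exact h1 i)
    rw [norm_smul, mul_comm]
    gcongr
    exact hC i x
  refine ⟨fun x => ∑ i, χ i x * ψ i x, ContDiff.sum fun i _ => (hχ i).mul (hψ i), ?_, ?_⟩
  · have e : (fun x => (∑ i, χ i x * ψ i x) - fn u x)
        =ᵐ[vol Ω] ∑ i, fun x => χ i x * (ψ i x - fn u x) := by
      filter_upwards [ae_restrict_mem hopen.measurableSet] with x hx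
      simp only [Finset.sum_apply, mul_sub, Finset.sum_sub_distrib, ← Finset.sum_mul,
        hsum x (subset_closure hx), one_mul]
    rw [eLpNorm_congr_ae e]
    refine (eLpNorm_sum_le (fun i _ => (hχm i).mul (hm i)) (by norm_num)).trans ?_
    refine (Finset.sum_le_card_nsmul _ _ _ fun i _ => b1 i).trans ?_
    rw [nsmul_eq_mul, Finset.card_univ]
    refine le_trans ?_ hηle
    gcongr
    exact le_add_self
  · have e : (fun y => gradient (fun x => ∑ i, χ i x * ψ i x) y - wgrad u y) =ᵐ[vol Ω]
        ∑ i, fun x => ((ψ i x - fn u x) • gradient (χ i) x + χ i x • (Ψ i x - wgrad u x)) := by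
      filter_upwards [ae_restrict_mem hopen.measurableSet] with y hy
      have hχΨ : ∀ i, χ i y • gradient (ψ i) y = χ i y • Ψ i y := by
        intro i
        by_cases h0 : χ i y = 0
        · simp [h0]
        · rw [h3 i y (hcone i (htΩ i.2) (ε i) (hε i) (hεε₀ i) y ⟨hy, hχr i y h0⟩)]
      -- The gradients of the partition functions add up to zero on the open set `Ω`.
      have hg0 : ∑ i, gradient (χ i) y = 0 := by
        have hs1 : (fun x => ∑ i, χ i x * (fun _ => (1 : ℝ)) x) =ᶠ[𝓝 y] fun _ => 1 := by
          filter_upwards [hopen.mem_nhds hy] with x hx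
          simpa using hsum x (subset_closure hx)
        have := gradient_sum_mul (ψ := fun _ _ => 1) hχ (fun _ => contDiff_const) y
        rw [hs1.gradient_eq, gradient_fun_const] at this
        simpa using this.symm
      rw [gradient_sum_mul hχ hψ]
      simp only [Finset.sum_apply, sub_smul, smul_sub, Finset.sum_add_distrib,
        Finset.sum_sub_distrib, ← Finset.sum_smul, ← Finset.smul_sum, hχΨ, hg0,
        hsum y (subset_closure hy), one_smul, smul_zero, sub_zero]
      abel
    rw [eLpNorm_congr_ae e]
    refine (eLpNorm_sum_le (fun i _ => ((hm i).smul (hχg i)).add ((hχm i).smul (hM i)))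
      (by norm_num)).trans ?_
    refine (Finset.sum_le_card_nsmul _ _ (ENNReal.ofReal C * η' + η') fun i _ =>
      (eLpNorm_add_le ((hm i).smul (hχg i)) ((hχm i).smul (hM i)) (by norm_num)).trans
        (add_le_add (b3 i) (b2 i))).trans ?_
    rwa [nsmul_eq_mul, Finset.card_univ]

/-! ### The trace inequality for smooth functions -/

/-- One-dimensional trace inequality: an endpoint value is controlled by the function and its
derivative on an adjacent interval. -/
theorem enorm_sq_endpoint_le {g : ℝ → ℝ} (hg : ContDiff ℝ 1 g) (δ : ℝ) :
    ENNReal.ofReal δ * ‖g 0‖ₑ ^ 2 ≤ 2 * (∫⁻ t in Set.Ioc 0 δ, ‖g t‖ₑ ^ 2)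
      + 2 * ENNReal.ofReal δ ^ 2 * ∫⁻ t in Set.Ioc 0 δ, ‖deriv g t‖ₑ ^ 2 := by
  have hg' : Continuous (deriv g) := hg.continuous_deriv (by simp)
  set μ : Measure ℝ := volume.restrict (Set.Ioc 0 δ) with hμ
  have hμu : μ Set.univ = ENNReal.ofReal δ := by simp [hμ]
  have hCS : (∫⁻ t, ‖deriv g t‖ₑ ∂μ) ^ 2
      ≤ ENNReal.ofReal δ * ∫⁻ t, ‖deriv g t‖ₑ ^ 2 ∂μ := by
    have h1 := eLpNorm_le_eLpNorm_mul_rpow_measure_univ (μ := μ) (p := 1) (q := 2) (by norm_num)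
      hg'.aestronglyMeasurable
    have h2 := eLpNorm_nnreal_pow_eq_lintegral (f := deriv g) (μ := μ) (p := 2) (by norm_num)
    rw [eLpNorm_one_eq_lintegral_enorm, hμu] at h1
    calc (∫⁻ t, ‖deriv g t‖ₑ ∂μ) ^ 2
        ≤ (eLpNorm (deriv g) 2 μ
            * ENNReal.ofReal δ ^ (1 / (1 : ℝ≥0∞).toReal - 1 / (2 : ℝ≥0∞).toReal)) ^ 2 := by gcongr
      _ = ENNReal.ofReal δ * eLpNorm (deriv g) 2 μ ^ 2 := by
          rw [mul_pow, mul_comm, ← ENNReal.rpow_natCast (_ ^ _) 2, ← ENNReal.rpow_mul]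
          norm_num
      _ = _ := by congr 1; simpa using h2
  have hpt : ∀ t ∈ Set.Ioc 0 δ, ‖g 0‖ₑ ≤ ‖g t‖ₑ + ∫⁻ t, ‖deriv g t‖ₑ ∂μ := by
    intro t ht
    have hFTC : g t - g 0 = ∫ x in (0 : ℝ)..t, deriv g x :=
      (intervalIntegral.integral_deriv_eq_sub
        (fun x _ => hg.differentiable (by simp) x) (hg'.intervalIntegrable _ _)).symm
    have h0 : g 0 = g t - (g t - g 0) := by ring
    have h1 : ‖g t - g 0‖ₑ ≤ ∫⁻ t, ‖deriv g t‖ₑ ∂μ := by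
      rw [hFTC, intervalIntegral.integral_of_le ht.1.le]
      refine (enorm_integral_le_lintegral_enorm _).trans ?_
      exact lintegral_mono_set (Set.Ioc_subset_Ioc_right ht.2)
    calc ‖g 0‖ₑ = ‖g t - (g t - g 0)‖ₑ := by rw [← h0]
      _ ≤ ‖g t‖ₑ + ‖g t - g 0‖ₑ := enorm_sub_le
      _ ≤ _ := by gcongr
  have hsq : ∀ a b : ℝ≥0∞, (a + b) ^ 2 ≤ 2 * (a ^ 2 + b ^ 2) := by
    intro a b
    have := ENNReal.rpow_add_le_mul_rpow_add_rpow a b (p := 2) (by norm_num)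
    norm_num at this
    exact_mod_cast this
  calc ENNReal.ofReal δ * ‖g 0‖ₑ ^ 2 = ∫⁻ t, ‖g 0‖ₑ ^ 2 ∂μ := by
        rw [lintegral_const, hμu, mul_comm]
    _ ≤ ∫⁻ t, (2 * ‖g t‖ₑ ^ 2 + 2 * (∫⁻ t, ‖deriv g t‖ₑ ∂μ) ^ 2) ∂μ := by
        refine setLIntegral_mono' measurableSet_Ioc fun t ht => ?_
        rw [← mul_add]
        refine le_trans ?_ (hsq _ _)
        gcongr
        exact hpt t ht
    _ = 2 * (∫⁻ t, ‖g t‖ₑ ^ 2 ∂μ) + ENNReal.ofReal δ * (2 * (∫⁻ t, ‖deriv g t‖ₑ ∂μ) ^ 2) := by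
        rw [lintegral_add_right _ measurable_const, lintegral_const_mul, lintegral_const, hμu,
          mul_comm (ENNReal.ofReal δ)]
        exact hg.continuous.enorm.measurable.pow_const 2
    _ ≤ 2 * (∫⁻ t, ‖g t‖ₑ ^ 2 ∂μ)
        + ENNReal.ofReal δ * (2 * (ENNReal.ofReal δ * ∫⁻ t, ‖deriv g t‖ₑ ^ 2 ∂μ)) := by
        gcongr
    _ = _ := by ring

section Graph

variable (R : Plane ≃ₗᵢ[ℝ] Plane) (γ : ℝ → ℝ)

/-- The point over `s` of the graph of `γ`, where `R` maps to the coordinates of the graph. -/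
noncomputable def graphPoint (s : ℝ) : Plane := R.symm (WithLp.toLp 2 ![s, γ s])

/-- The unit vector along which the graph coordinates measure height. -/
noncomputable def vertical : Plane := R.symm (WithLp.toLp 2 ![0, 1])

theorem norm_vertical : ‖vertical R‖ = 1 := by
  simp [vertical, EuclideanSpace.norm_eq]

theorem apply_graphPoint_add (s t : ℝ) :
    R (graphPoint R γ s + t • vertical R) = WithLp.toLp 2 ![s, γ s + t] := by
  rw [graphPoint, vertical, map_add, map_smul, LinearIsometryEquiv.apply_symm_apply,
    LinearIsometryEquiv.apply_symm_apply]
  ext i; fin_cases i <;> simp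

variable {γ}

theorem lipschitzWith_graphPoint {K : NNReal} (hγ : LipschitzWith K γ) :
    LipschitzWith (1 + K) (graphPoint R γ) := by
  refine LipschitzWith.of_dist_le_mul fun s t => ?_
  rw [graphPoint, graphPoint, LinearIsometryEquiv.dist_map, EuclideanSpace.dist_eq]
  have h := hγ.dist_le_mul s t
  simp only [Fin.sum_univ_two, Matrix.cons_val_zero, Matrix.cons_val_one]
  refine Real.sqrt_le_iff.2 ⟨by positivity, ?_⟩
  push_cast
  have h0 : 0 ≤ dist s t := dist_nonneg
  have h1 : 0 ≤ dist (γ s) (γ t) := dist_nonneg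
  have h2 : (0 : ℝ) ≤ K := K.2
  calc dist s t ^ 2 + dist (γ s) (γ t) ^ 2 ≤ dist s t ^ 2 + (K * dist s t) ^ 2 := by gcongr
    _ ≤ ((1 + K) * dist s t) ^ 2 := by nlinarith [mul_nonneg h2 (sq_nonneg (dist s t))]

/-- The coordinates `(s, t) ↦ ` "the point at height `t` over the graph point of `s`" preserve
area. -/
theorem measurePreserving_graph_coordinates (hγ : Continuous γ) :
    MeasurePreserving (fun p : ℝ × ℝ => graphPoint R γ p.1 + p.2 • vertical R)
      (volume.prod volume) volume := by
  have h1 : MeasurePreserving (fun p : ℝ × ℝ => (p.1, γ p.1 + p.2)) (volume.prod volume)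
      (volume.prod volume) :=
    (MeasurePreserving.id volume).skew_product
      (g := fun s t => γ s + t) ((hγ.comp continuous_fst).add continuous_snd).measurable
      (ae_of_all _ fun s => (measurePreserving_add_left volume (γ s)).map_eq)
  have h2 := (volume_preserving_finTwoArrow ℝ).symm
  have h3 := PiLp.volume_preserving_toLp (Fin 2)
  have h4 := R.symm.measurePreserving
  have e : (fun p : ℝ × ℝ => graphPoint R γ p.1 + p.2 • vertical R) =
      R.symm ∘ WithLp.toLp 2 ∘ MeasurableEquiv.finTwoArrow.symm ∘
        fun p : ℝ × ℝ => (p.1, γ p.1 + p.2) := by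
    funext p
    rw [← R.symm_apply_apply (graphPoint R γ p.1 + p.2 • vertical R), apply_graphPoint_add]
    rfl
  rw [e]
  exact h4.comp (h3.comp (h2.comp h1))

/-- Arc length on the graph of a Lipschitz function is bounded by a multiple of length on the
axis. -/
theorem hausdorffMeasure_restrict_le_map_graphPoint {K : NNReal} (hγ : LipschitzWith K γ)
    {A : Set Plane} (hAγ : A ⊆ Set.range (graphPoint R γ)) :
    (Measure.hausdorffMeasure 1 : Measure Plane).restrict A
      ≤ ((1 + K : NNReal) : ℝ≥0∞) •
        Measure.map (graphPoint R γ) (volume.restrict (graphPoint R γ ⁻¹' A)) := by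
  have hL := lipschitzWith_graphPoint R hγ
  refine Measure.le_iff.2 fun E hE => ?_
  rw [Measure.restrict_apply hE, Measure.smul_apply, Measure.map_apply hL.continuous.measurable hE,
    Measure.restrict_apply (hL.continuous.measurable hE), ← Set.preimage_inter,
    ← Set.image_preimage_eq_of_subset (Set.inter_subset_right.trans hAγ)]
  refine (hL.hausdorffMeasure_image_le zero_le_one _).trans ?_
  rw [hausdorffMeasure_real, ENNReal.rpow_one, smul_eq_mul,
    Set.image_preimage_eq_of_subset (Set.inter_subset_right.trans hAγ)]

end Graph

/-- Trace inequality on a part `A` of the boundary: the arc length of `A` is finite and the `L²(A)`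
norm of smooth functions is bounded by the `H¹(Ω)` norm. The norms are squared and may be infinite,
and `A` is arbitrary, so that the property is stable under subsets and finite unions. -/
def HasTraceInequality (Ω A : Set Plane) : Prop :=
  (Measure.hausdorffMeasure 1 : Measure Plane) A < ⊤ ∧ ∃ C : ℝ≥0∞, C ≠ ⊤ ∧
    ∀ φ : Plane → ℝ, ContDiff ℝ ∞ φ →
      ∫⁻ x in A, ‖φ x‖ₑ ^ 2 ∂(Measure.hausdorffMeasure 1 : Measure Plane) ≤
        C * ((∫⁻ x in Ω, ‖φ x‖ₑ ^ 2) + ∫⁻ x in Ω, ‖gradient φ x‖ₑ ^ 2)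

/-- Local trace inequality: the one-dimensional inequality is applied on the vertical segments of
length `r / 4` over the graph, which stay inside `Ω`, and integrated over the base. -/
theorem exists_ball_hasTraceInequality {Ω : Set Plane} (hopen : IsOpen Ω)
    (hlip : HasLipschitzBoundary Ω) {x : Plane} (hx : x ∈ frontier Ω) :
    ∃ r > 0, HasTraceInequality Ω (frontier Ω ∩ Metric.ball x r) := by
  obtain ⟨R, K, γ, r, hγ, hr, hΩ⟩ := hlip x hx
  refine ⟨r / 2, by positivity, ?_⟩
  set A := frontier Ω ∩ Metric.ball x (r / 2) with hAdef
  have hAm : MeasurableSet A :=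
    isClosed_frontier.measurableSet.inter Metric.isOpen_ball.measurableSet
  -- Inside the ball, the frontier is the graph: below it there is a neighbourhood free of `Ω`.
  have hAγ : A ⊆ Set.range (graphPoint R γ) := by
    rintro y ⟨hy, hyb⟩
    have hyr : y ∈ Metric.ball x r := Metric.ball_subset_ball (by linarith) hyb
    refine ⟨R y 0, ?_⟩
    have hle : R y 1 ≤ γ (R y 0) := by
      rw [frontier, hopen.interior_eq] at hy
      exact not_lt.1 fun h => hy.2 ((hΩ y hyr).2 h)
    have hge : γ (R y 0) ≤ R y 1 := by
      by_contra! hlt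
      have hcont : Continuous fun z : Plane => γ (R z 0) - R z 1 := by
        have := hγ.continuous
        fun_prop
      have hnhds : {z : Plane | 0 < γ (R z 0) - R z 1} ∩ Metric.ball x r ∈ 𝓝 y :=
        inter_mem ((isOpen_lt continuous_const hcont).mem_nhds (by simpa using hlt))
          (Metric.isOpen_ball.mem_nhds hyr)
      obtain ⟨z, ⟨hz1, hz2⟩, hz⟩ := mem_closure_iff_nhds.1 hy.1 _ hnhds
      have := (hΩ z hz2).1 hz
      have hz1 : 0 < γ (R z 0) - R z 1 := hz1
      linarith
    rw [graphPoint, LinearIsometryEquiv.symm_apply_eq]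
    ext i; fin_cases i <;> simp [le_antisymm hge hle]
  have hL := lipschitzWith_graphPoint R hγ
  set S := graphPoint R γ ⁻¹' A with hS
  have hSm : MeasurableSet S := hL.continuous.measurable hAm
  have hmap := hausdorffMeasure_restrict_le_map_graphPoint R hγ hAγ
  have hSfin : volume S < ⊤ := by
    refine (measure_mono (t := Metric.ball (R x 0) r) fun s hs => ?_).trans_lt measure_ball_lt_top
    have h1 : dist (graphPoint R γ s) x < r / 2 := hs.2
    have h2 : dist (R (graphPoint R γ s)) (R x) < r / 2 := by rwa [R.dist_map]
    have h3 := (PiLp.norm_apply_le (R (graphPoint R γ s) - R x) 0)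
    rw [← dist_eq_norm] at h3
    have h4 : R (graphPoint R γ s) 0 = s := by simp [graphPoint]
    rw [PiLp.sub_apply, h4, ← dist_eq_norm] at h3
    rw [Metric.mem_ball]
    linarith
  refine ⟨?_, ?_⟩
  · rw [← Measure.restrict_apply_univ]
    refine (hmap _).trans_lt ?_
    rw [Measure.smul_apply, Measure.map_apply hL.continuous.measurable MeasurableSet.univ,
      Set.preimage_univ, Measure.restrict_apply_univ, smul_eq_mul]
    exact ENNReal.mul_lt_top ENNReal.coe_lt_top hSfin
  set δ : ℝ := r / 4 with hδdef
  have hδ : 0 < δ := by positivity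
  have hcoord := measurePreserving_graph_coordinates R hγ.continuous
  set P : ℝ × ℝ → Plane := fun p => graphPoint R γ p.1 + p.2 • vertical R with hP
  have hPΩ : ∀ p ∈ S ×ˢ Set.Ioc 0 δ, P p ∈ Ω := by
    rintro ⟨s, t⟩ ⟨hs, ht⟩
    have h1 : dist (graphPoint R γ s) x < r / 2 := hs.2
    have h2 : dist (P (s, t)) (graphPoint R γ s) = t := by
      simp [hP, dist_eq_norm, norm_smul, norm_vertical, abs_of_pos ht.1]
    have h3 : P (s, t) ∈ Metric.ball x r := by
      rw [Metric.mem_ball]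
      have := dist_triangle (P (s, t)) (graphPoint R γ s) x
      have := ht.2
      linarith
    rw [hΩ _ h3]
    simp only [hP, apply_graphPoint_add]
    simpa using ht.1
  -- The vertical segments fill a part of `Ω`, and the graph coordinates preserve area.
  have hstrip : ∀ f : Plane → ℝ≥0∞, Measurable f →
      ∫⁻ s in S, ∫⁻ t in Set.Ioc 0 δ, f (P (s, t)) ≤ ∫⁻ y in Ω, f y := by
    intro f hf
    rw [← setLIntegral_prod (fun p => f (P p)) (hf.comp hcoord.measurable).aemeasurable,
      ← lintegral_indicator hopen.measurableSet,
      ← hcoord.lintegral_comp (hf.indicator hopen.measurableSet),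
      ← lintegral_indicator (hSm.prod measurableSet_Ioc)]
    refine lintegral_mono fun p => ?_
    by_cases hp : p ∈ S ×ˢ Set.Ioc 0 δ
    · rw [Set.indicator_of_mem hp, Set.indicator_of_mem (hPΩ p hp)]
    · rw [Set.indicator_of_notMem hp]; exact zero_le
  set D := ENNReal.ofReal δ with hD
  have hD0 : D ≠ 0 := by simpa [hD] using hδ
  have hDt : D ≠ ⊤ := ENNReal.ofReal_ne_top
  refine ⟨((1 + K : NNReal) : ℝ≥0∞) * (D⁻¹ * (2 + 2 * D ^ 2)),
    by have := ENNReal.inv_ne_top.2 hD0; finiteness, fun φ hφ => ?_⟩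
  have hφm : Measurable fun y => ‖φ y‖ₑ ^ 2 := hφ.continuous.enorm.measurable.pow_const 2
  have hgm : Measurable fun y => ‖gradient φ y‖ₑ ^ 2 :=
    (continuous_gradient hφ).enorm.measurable.pow_const 2
  have hline : ∀ s, D * ‖φ (graphPoint R γ s)‖ₑ ^ 2
      ≤ 2 * (∫⁻ t in Set.Ioc 0 δ, ‖φ (P (s, t))‖ₑ ^ 2)
        + 2 * D ^ 2 * ∫⁻ t in Set.Ioc 0 δ, ‖gradient φ (P (s, t))‖ₑ ^ 2 := by
    intro s
    have hg : ContDiff ℝ 1 fun t : ℝ => φ (P (s, t)) := by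
      have := hφ.of_le (m := 1) (by simp)
      simp only [hP]
      fun_prop
    have h1 := enorm_sq_endpoint_le hg δ
    have h0 : P (s, 0) = graphPoint R γ s := by simp [hP]
    rw [h0] at h1
    refine h1.trans ?_
    gcongr with t
    have hd : HasDerivAt (fun t : ℝ => φ (P (s, t))) (fderiv ℝ φ (P (s, t)) (vertical R)) t := by
      refine (hφ.differentiable (by simp) _).hasFDerivAt.comp_hasDerivAt t ?_
      have h := ((hasDerivAt_id t).smul_const (vertical R)).const_add (graphPoint R γ s)
      rwa [one_smul] at h
    rw [hd.deriv, ← inner_gradient_left, enorm_le_iff_norm_le]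
    refine (norm_inner_le_norm _ _).trans ?_
    rw [norm_vertical, mul_one]
  calc ∫⁻ y in A, ‖φ y‖ₑ ^ 2 ∂(Measure.hausdorffMeasure 1 : Measure Plane)
      ≤ ((1 + K : NNReal) : ℝ≥0∞) * ∫⁻ s in S, ‖φ (graphPoint R γ s)‖ₑ ^ 2 := by
        refine (lintegral_mono' hmap le_rfl).trans ?_
        rw [lintegral_smul_measure, lintegral_map hφm hL.continuous.measurable, smul_eq_mul]
    _ ≤ ((1 + K : NNReal) : ℝ≥0∞) * (D⁻¹ * ∫⁻ s in S,
          (2 * (∫⁻ t in Set.Ioc 0 δ, ‖φ (P (s, t))‖ₑ ^ 2)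
            + 2 * D ^ 2 * ∫⁻ t in Set.Ioc 0 δ, ‖gradient φ (P (s, t))‖ₑ ^ 2)) := by
        gcongr
        rw [← ENNReal.inv_mul_le_iff (by simpa using hDt) (by simpa using hD0), inv_inv,
          ← lintegral_const_mul' _ _ hDt]
        exact lintegral_mono hline
    _ ≤ ((1 + K : NNReal) : ℝ≥0∞) * (D⁻¹ * (2 * (∫⁻ y in Ω, ‖φ y‖ₑ ^ 2)
          + 2 * D ^ 2 * ∫⁻ y in Ω, ‖gradient φ y‖ₑ ^ 2)) := by
        gcongr
        rw [lintegral_add_left, lintegral_const_mul' _ _ (by simp),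
          lintegral_const_mul' _ _ (by finiteness)]
        · gcongr
          · exact hstrip _ hφm
          · exact hstrip _ hgm
        · exact ((hφm.comp hcoord.measurable).lintegral_prod_right').const_mul 2
    _ ≤ ((1 + K : NNReal) : ℝ≥0∞) * (D⁻¹ * ((2 + 2 * D ^ 2) * (∫⁻ y in Ω, ‖φ y‖ₑ ^ 2)
          + (2 + 2 * D ^ 2) * ∫⁻ y in Ω, ‖gradient φ y‖ₑ ^ 2)) := by
        gcongr
        · exact le_self_add
        · exact le_add_self
    _ = _ := by ring

/-- The trace inequality on the whole boundary of a bounded Lipschitz domain. -/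
theorem hasTraceInequality_frontier {Ω : Set Plane} (hopen : IsOpen Ω)
    (hbdd : Bornology.IsBounded Ω) (hlip : HasLipschitzBoundary Ω) :
    HasTraceInequality Ω (frontier Ω) := by
  have hc : IsCompact (frontier Ω) :=
    hbdd.isCompact_closure.of_isClosed_subset isClosed_frontier frontier_subset_closure
  refine hc.induction_on (p := HasTraceInequality Ω) ?_ ?_ ?_ ?_
  · exact ⟨by simp, 0, by simp, fun φ _ => by simp⟩
  · rintro s t hst ⟨ht, C, hC, h⟩
    exact ⟨(measure_mono hst).trans_lt ht, C, hC,
      fun φ hφ => (lintegral_mono_set hst).trans (h φ hφ)⟩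
  · rintro s t ⟨hs, C, hC, h⟩ ⟨ht, C', hC', h'⟩
    refine ⟨(measure_union_le _ _).trans_lt (ENNReal.add_lt_top.2 ⟨hs, ht⟩), C + C',
      ENNReal.add_ne_top.2 ⟨hC, hC'⟩, fun φ hφ => (lintegral_union_le _ _ _).trans ?_⟩
    rw [add_mul]
    exact add_le_add (h φ hφ) (h' φ hφ)
  · intro x hx
    obtain ⟨r, hr, h⟩ := exists_ball_hasTraceInequality hopen hlip hx
    exact ⟨_, inter_mem self_mem_nhdsWithin (mem_nhdsWithin_of_mem_nhds
      (Metric.ball_mem_nhds x hr)),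
      h⟩

/-! ### The trace operator -/

section Trace

variable {Ω : Set Plane}

theorem norm_sq_eq (u : H1 Ω) : ‖u‖ ^ 2 = ‖fn u‖ ^ 2 + ‖wgrad u‖ ^ 2 :=
  WithLp.prod_norm_sq_eq_of_L2 (u : WithLp 2 (Lp ℝ 2 (vol Ω) × Lp Plane 2 (vol Ω)))

theorem norm_fn_le (u : H1 Ω) : ‖fn u‖ ≤ ‖u‖ :=
  abs_le_of_sq_le_sq' (by rw [norm_sq_eq]; linarith [sq_nonneg ‖wgrad u‖]) (norm_nonneg _) |>.2

theorem norm_wgrad_le (u : H1 Ω) : ‖wgrad u‖ ≤ ‖u‖ :=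
  abs_le_of_sq_le_sq' (by rw [norm_sq_eq]; linarith [sq_nonneg ‖fn u‖]) (norm_nonneg _) |>.2

theorem gradient_fun_add {φ ψ : Plane → ℝ} (hφ : ContDiff ℝ ∞ φ) (hψ : ContDiff ℝ ∞ ψ)
    (x : Plane) : gradient (fun x => φ x + ψ x) x = gradient φ x + gradient ψ x := by
  simp only [gradient]
  rw [fderiv_fun_add (hφ.differentiable (by simp) x) (hψ.differentiable (by simp) x), map_add]

theorem gradient_fun_const_mul {φ : Plane → ℝ} (hφ : ContDiff ℝ ∞ φ) (c : ℝ)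
    (x : Plane) : gradient (fun x => c * φ x) x = c • gradient φ x := by
  simp only [gradient]
  rw [fderiv_const_mul (hφ.differentiable (by simp) x)]
  simp

theorem IsTrace.add {u v : H1 Ω} {g h : Lp ℝ 2 (surf Ω)} (hu : IsTrace u g) (hv : IsTrace v h) :
    IsTrace (u + v) (g + h) := by
  obtain ⟨φ, hφ, a1, a2, a3⟩ := hu
  obtain ⟨ψ, hψ, b1, b2, b3⟩ := hv
  refine ⟨fun n x => φ n x + ψ n x, fun n => (hφ n).add (hψ n), ?_, ?_, ?_⟩
  · refine tendsto_of_tendsto_of_tendsto_of_le_of_le tendsto_const_nhds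
      (by simpa using a1.add b1) (fun _ => zero_le) fun n => ?_
    refine le_trans (le_of_eq (eLpNorm_congr_ae ?_)) (eLpNorm_add_le
      ((hφ n).continuous.aestronglyMeasurable.sub (Lp.aestronglyMeasurable (fn u)))
      ((hψ n).continuous.aestronglyMeasurable.sub (Lp.aestronglyMeasurable (fn v))) (by norm_num))
    filter_upwards [Lp.coeFn_add (fn u) (fn v)] with x hx
    have : (fn (u + v)) x = _ := hx
    simp only [Pi.add_apply, this]
    abel
  · refine tendsto_of_tendsto_of_tendsto_of_le_of_le tendsto_const_nhds
      (by simpa using a2.add b2) (fun _ => zero_le) fun n => ?_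
    refine le_trans (le_of_eq (eLpNorm_congr_ae ?_)) (eLpNorm_add_le
      ((continuous_gradient (hφ n)).aestronglyMeasurable.sub (Lp.aestronglyMeasurable (wgrad u)))
      ((continuous_gradient (hψ n)).aestronglyMeasurable.sub (Lp.aestronglyMeasurable (wgrad v)))
      (by norm_num))
    filter_upwards [Lp.coeFn_add (wgrad u) (wgrad v)] with x hx
    have : (wgrad (u + v)) x = _ := hx
    simp only [Pi.add_apply, this, gradient_fun_add (hφ n) (hψ n)]
    abel
  · refine tendsto_of_tendsto_of_tendsto_of_le_of_le tendsto_const_nhds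
      (by simpa using a3.add b3) (fun _ => zero_le) fun n => ?_
    refine le_trans (le_of_eq (eLpNorm_congr_ae ?_)) (eLpNorm_add_le
      ((hφ n).continuous.aestronglyMeasurable.sub (Lp.aestronglyMeasurable g))
      ((hψ n).continuous.aestronglyMeasurable.sub (Lp.aestronglyMeasurable h)) (by norm_num))
    filter_upwards [Lp.coeFn_add g h] with x hx
    simp only [Pi.add_apply, hx]
    abel

theorem IsTrace.const_smul {u : H1 Ω} {g : Lp ℝ 2 (surf Ω)} (hu : IsTrace u g) (c : ℝ) :
    IsTrace (c • u) (c • g) := by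
  obtain ⟨φ, hφ, a1, a2, a3⟩ := hu
  have hc : ∀ {f : ℕ → ℝ≥0∞}, Tendsto f atTop (𝓝 0) →
      Tendsto (fun n => ‖c‖ₑ * f n) atTop (𝓝 0) := fun h => by
    simpa using ENNReal.Tendsto.const_mul h (Or.inr (by simp))
  refine ⟨fun n x => c * φ n x, fun n => contDiff_const.mul (hφ n), (hc a1).congr fun n => ?_,
    (hc a2).congr fun n => ?_, (hc a3).congr fun n => ?_⟩
  · rw [← eLpNorm_const_smul]
    refine eLpNorm_congr_ae ?_
    filter_upwards [Lp.coeFn_smul c (fn u)] with x hx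
    have : (fn (c • u)) x = _ := hx
    simp only [Pi.smul_apply, this, smul_eq_mul, mul_sub]
  · rw [← eLpNorm_const_smul]
    refine eLpNorm_congr_ae ?_
    filter_upwards [Lp.coeFn_smul c (wgrad u)] with x hx
    have : (wgrad (c • u)) x = _ := hx
    simp only [Pi.smul_apply, this, gradient_fun_const_mul (hφ n), smul_sub]
  · rw [← eLpNorm_const_smul]
    refine eLpNorm_congr_ae ?_
    filter_upwards [Lp.coeFn_smul c g] with x hx
    simp only [Pi.smul_apply, hx, smul_eq_mul, mul_sub]

theorem HasTraceInequality.isFiniteMeasure (h : HasTraceInequality Ω (frontier Ω)) :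
    IsFiniteMeasure (surf Ω) := ⟨by rw [Measure.restrict_apply_univ]; exact h.1⟩

theorem HasTraceInequality.exists_eLpNorm_le (h : HasTraceInequality Ω (frontier Ω)) :
    ∃ C : ℝ≥0∞, C ≠ ⊤ ∧ ∀ φ : Plane → ℝ, ContDiff ℝ ∞ φ →
      eLpNorm φ 2 (surf Ω) ≤ C * (eLpNorm φ 2 (vol Ω) + eLpNorm (gradient φ) 2 (vol Ω)) := by
  obtain ⟨-, C, hC, hφ⟩ := h
  refine ⟨1 + C, by finiteness, fun φ h => ?_⟩
  have e1 : ∀ μ : Measure Plane, eLpNorm φ 2 μ ^ 2 = ∫⁻ x, ‖φ x‖ₑ ^ 2 ∂μ := fun μ => by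
    simpa using eLpNorm_nnreal_pow_eq_lintegral (f := φ) (μ := μ) (p := 2) (by norm_num)
  have e2 : eLpNorm (gradient φ) 2 (vol Ω) ^ 2 = ∫⁻ x, ‖gradient φ x‖ₑ ^ 2 ∂(vol Ω) := by
    simpa using eLpNorm_nnreal_pow_eq_lintegral (f := gradient φ) (μ := vol Ω) (p := 2)
      (by norm_num)
  have h1 := hφ φ h
  rw [← e1, ← e1, ← e2] at h1
  rw [← ENNReal.pow_le_pow_left_iff (n := 2) (by norm_num)]
  refine h1.trans ?_
  rw [mul_pow]
  gcongr
  · calc C ≤ 1 + C := le_add_self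
      _ = (1 + C) * 1 := (mul_one _).symm
      _ ≤ (1 + C) * (1 + C) := by gcongr; exact le_self_add
      _ = _ := (sq _).symm
  · set a := eLpNorm φ 2 (vol Ω)
    set b := eLpNorm (gradient φ) 2 (vol Ω)
    calc a ^ 2 + b ^ 2 ≤ a ^ 2 + b ^ 2 + 2 * a * b := le_self_add
      _ = (a + b) ^ 2 := by ring

/-- The trace inequality passes to the limit: any trace of `u` is bounded by the `H¹` norm of `u`.
By linearity, traces are therefore unique. -/
theorem HasTraceInequality.exists_norm_le (h : HasTraceInequality Ω (frontier Ω)) :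
    ∃ C : ℝ, ∀ (u : H1 Ω) (g : Lp ℝ 2 (surf Ω)), IsTrace u g → ‖g‖ ≤ C * ‖u‖ := by
  obtain ⟨C, hC, hφC⟩ := h.exists_eLpNorm_le
  refine ⟨2 * C.toReal, fun u g ⟨φ, hφ, a1, a2, a3⟩ => ?_⟩
  have hlim : Tendsto (fun n => eLpNorm (fun x => φ n x - g x) 2 (surf Ω) +
      C * ((eLpNorm (fun x => φ n x - fn u x) 2 (vol Ω) + eLpNorm (fn u) 2 (vol Ω)) +
        (eLpNorm (fun x => gradient (φ n) x - wgrad u x) 2 (vol Ω)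
          + eLpNorm (wgrad u) 2 (vol Ω)))) atTop
      (𝓝 (0 + C * ((0 + eLpNorm (fn u) 2 (vol Ω)) + (0 + eLpNorm (wgrad u) 2 (vol Ω))))) :=
    a3.add (ENNReal.Tendsto.const_mul ((a1.add tendsto_const_nhds).add
      (a2.add tendsto_const_nhds)) (Or.inr hC))
  have hle : eLpNorm g 2 (surf Ω)
      ≤ C * (eLpNorm (fn u) 2 (vol Ω) + eLpNorm (wgrad u) 2 (vol Ω)) := by
    have := ge_of_tendsto' hlim (b := eLpNorm g 2 (surf Ω)) fun n => ?_
    · simpa using this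
    have m1 : AEStronglyMeasurable (fun x => φ n x - g x) (surf Ω) :=
      (hφ n).continuous.aestronglyMeasurable.sub (Lp.aestronglyMeasurable g)
    have m2 : AEStronglyMeasurable (fun x => φ n x - fn u x) (vol Ω) :=
      (hφ n).continuous.aestronglyMeasurable.sub (Lp.aestronglyMeasurable _)
    have m3 : AEStronglyMeasurable (fun x => gradient (φ n) x - wgrad u x) (vol Ω) :=
      (continuous_gradient (hφ n)).aestronglyMeasurable.sub (Lp.aestronglyMeasurable _)
    calc eLpNorm g 2 (surf Ω) = eLpNorm (φ n - fun x => φ n x - g x) 2 (surf Ω) := by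
          congr 1; funext x; simp
      _ ≤ eLpNorm (φ n) 2 (surf Ω) + eLpNorm (fun x => φ n x - g x) 2 (surf Ω) :=
          eLpNorm_sub_le (hφ n).continuous.aestronglyMeasurable m1 (by norm_num)
      _ ≤ C * (eLpNorm (φ n) 2 (vol Ω) + eLpNorm (gradient (φ n)) 2 (vol Ω))
          + eLpNorm (fun x => φ n x - g x) 2 (surf Ω) := by gcongr; exact hφC _ (hφ n)
      _ ≤ _ := by
          rw [add_comm]
          gcongr
          · refine le_trans (le_of_eq ?_) (eLpNorm_add_le m2 (Lp.aestronglyMeasurable (fn u))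
              (by norm_num))
            congr 1; funext x; simp
          · refine le_trans (le_of_eq ?_) (eLpNorm_add_le m3 (Lp.aestronglyMeasurable (wgrad u))
              (by norm_num))
            congr 1; funext x; simp
  have := ENNReal.toReal_mono (ENNReal.mul_ne_top hC (ENNReal.add_ne_top.2
    ⟨Lp.eLpNorm_ne_top (fn u), Lp.eLpNorm_ne_top (wgrad u)⟩)) hle
  rw [ENNReal.toReal_mul, ENNReal.toReal_add (Lp.eLpNorm_ne_top (fn u))
    (Lp.eLpNorm_ne_top (wgrad u)), ← Lp.norm_def, ← Lp.norm_def, ← Lp.norm_def] at this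
  refine this.trans ?_
  have h0 : 0 ≤ C.toReal := ENNReal.toReal_nonneg
  nlinarith [norm_fn_le u, norm_wgrad_le u]

theorem memLp_surf_of_continuous [IsFiniteMeasure (surf Ω)] (hbdd : Bornology.IsBounded Ω)
    {φ : Plane → ℝ} (hφ : Continuous φ) : MemLp φ 2 (surf Ω) := by
  have hc : IsCompact (frontier Ω) :=
    hbdd.isCompact_closure.of_isClosed_subset isClosed_frontier frontier_subset_closure
  obtain ⟨C, hC⟩ := hc.exists_bound_of_continuousOn hφ.continuousOn
  refine MemLp.of_bound hφ.aestronglyMeasurable C ?_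
  filter_upwards [ae_restrict_mem isClosed_frontier.measurableSet] with x hx using hC x hx

/-- Every `H¹` function on a bounded Lipschitz domain has a trace. -/
theorem exists_isTrace (hopen : IsOpen Ω) (hbdd : Bornology.IsBounded Ω)
    (hlip : HasLipschitzBoundary Ω) (u : H1 Ω) : ∃ g, IsTrace u g := by
  have htr := hasTraceInequality_frontier hopen hbdd hlip
  have := htr.isFiniteMeasure
  obtain ⟨C, hC, hφC⟩ := htr.exists_eLpNorm_le
  let η : ℕ → ℝ≥0∞ := fun n => ((n : ℝ≥0∞) + 1)⁻¹
  have hη0 : ∀ n, 0 < η n := fun n => ENNReal.inv_pos.2 (by finiteness)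
  have hηmono : Antitone η := fun m n hmn => by
    simp only [η]; gcongr
  have hη : Tendsto η atTop (𝓝 0) := by
    have h1 := (tendsto_add_atTop_iff_nat 1).2 ENNReal.tendsto_inv_nat_nhds_zero
    simpa [η] using h1
  choose φ hφ h1 h2 using fun n => exists_smooth_approx hopen hbdd hlip u (hη0 n)
  let f : ℕ → Lp ℝ 2 (surf Ω) := fun n => (memLp_surf_of_continuous hbdd (hφ n).continuous).toLp _
  have m2 : ∀ n, AEStronglyMeasurable (fun x => φ n x - fn u x) (vol Ω) := fun n =>
    (hφ n).continuous.aestronglyMeasurable.sub (Lp.aestronglyMeasurable _)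
  have m3 : ∀ n, AEStronglyMeasurable (fun x => gradient (φ n) x - wgrad u x) (vol Ω) := fun n =>
    (continuous_gradient (hφ n)).aestronglyMeasurable.sub (Lp.aestronglyMeasurable _)
  have hcau : CauchySeq f := by
    refine EMetric.cauchySeq_iff_le_tendsto_0.2 ⟨fun N => C * ((η N + η N) + (η N + η N)), ?_, ?_⟩
    · intro n m N hn hm
      simp only [f]
      rw [Lp.edist_toLp_toLp]
      have hneg : ContDiff ℝ ∞ fun x => (-1) * φ m x := contDiff_const.mul (hφ m)
      have hd : (φ n - φ m) = fun x => φ n x + (-1) * φ m x := by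
        funext x; simp [sub_eq_add_neg]
      rw [hd]
      refine (hφC _ ((hφ n).add hneg)).trans ?_
      gcongr
      · calc _ = eLpNorm ((fun x => φ n x - fn u x) - fun x => φ m x - fn u x) 2 (vol Ω) := by
              congr 1; funext x; simp only [Pi.sub_apply]; ring
          _ ≤ _ := (eLpNorm_sub_le (m2 n) (m2 m) (by norm_num)).trans
              (add_le_add ((h1 n).trans (hηmono hn)) ((h1 m).trans (hηmono hm)))
      · calc _ = eLpNorm ((fun x => gradient (φ n) x - wgrad u x)
              - fun x => gradient (φ m) x - wgrad u x) 2 (vol Ω) := by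
              congr 1; funext x
              rw [gradient_fun_add (hφ n) hneg, gradient_fun_const_mul (hφ m)]
              simp [sub_eq_add_neg]
          _ ≤ _ := (eLpNorm_sub_le (m3 n) (m3 m) (by norm_num)).trans
              (add_le_add ((h2 n).trans (hηmono hn)) ((h2 m).trans (hηmono hm)))
    · have := ENNReal.Tendsto.const_mul ((hη.add hη).add (hη.add hη)) (a := C) (Or.inr hC)
      simpa using this
  -- By the trace inequality, the boundary values form a Cauchy sequence in `L²(∂Ω)`.
  obtain ⟨g, hg⟩ := cauchySeq_tendsto_of_complete hcau
  refine ⟨g, φ, hφ, tendsto_of_tendsto_of_tendsto_of_le_of_le tendsto_const_nhds hη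
    (fun _ => zero_le) h1, tendsto_of_tendsto_of_tendsto_of_le_of_le tendsto_const_nhds hη
    (fun _ => zero_le) h2, ?_⟩
  refine ((Lp.tendsto_Lp_iff_tendsto_eLpNorm' f g).1 hg).congr fun n => eLpNorm_congr_ae ?_
  filter_upwards [(memLp_surf_of_continuous hbdd (hφ n).continuous).coeFn_toLp] with x hx
  simp [f, hx]

/-- The trace theorem: `trace` is a bounded linear operator `H¹(Ω) → L²(∂Ω)`. -/
theorem exists_traceCLM (hopen : IsOpen Ω) (hbdd : Bornology.IsBounded Ω)
    (hlip : HasLipschitzBoundary Ω) :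
    ∃ T : H1 Ω →L[ℝ] Lp ℝ 2 (surf Ω), ∀ u, T u = trace u := by
  obtain ⟨C, hC⟩ := (hasTraceInequality_frontier hopen hbdd hlip).exists_norm_le
  have hspec : ∀ u : H1 Ω, IsTrace u (trace u) := fun u => by
    have h := exists_isTrace hopen hbdd hlip u
    rw [trace, dif_pos h]
    exact h.choose_spec
  have huniq : ∀ (u : H1 Ω) (g : Lp ℝ 2 (surf Ω)), IsTrace u g → trace u = g := by
    intro u g hg
    have h1 := hC _ _ ((hspec u).add (hg.const_smul (-1)))
    simp only [neg_smul, one_smul, add_neg_cancel, norm_zero, mul_zero] at h1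
    have h2 := norm_le_zero_iff.1 h1
    rwa [← sub_eq_add_neg, sub_eq_zero] at h2
  let T : H1 Ω →ₗ[ℝ] Lp ℝ 2 (surf Ω) :=
    { toFun := trace
      map_add' := fun u v => huniq _ _ ((hspec u).add (hspec v))
      map_smul' := fun c u => huniq _ _ ((hspec u).const_smul c) }
  exact ⟨T.mkContinuous C fun u => hC u _ (hspec u), fun u => rfl⟩

end Trace

/-! ### Multiplication operators and completeness of `H¹(Ω)` -/

section Multiplication

variable {α E : Type*} [MeasurableSpace α] {μ : Measure α} [NormedAddCommGroup E]
  [InnerProductSpace ℝ E]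

/-- Multiplication by a bounded function is a bounded operator on `L²`. -/
theorem exists_mulCLM {a : α → ℝ} (ha : AEStronglyMeasurable a μ) {C : ℝ}
    (hC : ∀ᵐ x ∂μ, ‖a x‖ ≤ C) :
    ∃ M : Lp E 2 μ →L[ℝ] Lp E 2 μ, ∀ g, M g =ᵐ[μ] fun x => a x • g x := by
  have hm : MemLp a ⊤ μ := memLp_top_of_bound ha C hC
  refine ⟨(ContinuousLinearMap.lsmul ℝ ℝ : ℝ →L[ℝ] E →L[ℝ] E).holderL μ ⊤ 2 2 (hm.toLp a),
    fun g => ?_⟩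
  filter_upwards [(ContinuousLinearMap.lsmul ℝ ℝ : ℝ →L[ℝ] E →L[ℝ] E).coeFn_holder (r := 2)
    (hm.toLp a) g, hm.coeFn_toLp] with x h1 h2
  exact h1.trans (by simp [h2])

/-- If bounded coefficients converge in measure, their products with a fixed `L²` function converge
in `L²`. -/
theorem tendsto_eLpNorm_sub_smul_of_tendstoInMeasure {a : α → ℝ} {aε : ℕ → α → ℝ}
    (ha : AEStronglyMeasurable a μ) (haε : ∀ n, AEStronglyMeasurable (aε n) μ) {C : ℝ}
    (hC : ∀ n, ∀ᵐ x ∂μ, ‖a x - aε n x‖ ≤ C) (hlim : TendstoInMeasure μ aε atTop a) (g : Lp E 2 μ) :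
    Tendsto (fun n => eLpNorm (fun x => (a x - aε n x) • g x) 2 μ) atTop (𝓝 0) := by
  have e : ∀ f : α → E, eLpNorm f 2 μ = (∫⁻ x, ‖f x‖ₑ ^ 2 ∂μ) ^ (1 / 2 : ℝ) := fun f => by
    simpa using eLpNorm_eq_lintegral_rpow_enorm_toReal (f := f) (μ := μ) (p := 2)
      (by norm_num) (by norm_num)
  have hgfin : ∫⁻ x, ‖g x‖ₑ ^ 2 ∂μ ≠ ⊤ := by
    have h1 := eLpNorm_nnreal_pow_eq_lintegral (f := g) (μ := μ) (p := 2) (by norm_num)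
    have h2 : eLpNorm g 2 μ ^ 2 = ∫⁻ x, ‖g x‖ₑ ^ 2 ∂μ := by simpa using h1
    rw [← h2]
    exact ENNReal.pow_ne_top (Lp.eLpNorm_ne_top g)
  -- Convergence in measure gives almost everywhere convergence along subsequences, and these
  -- suffice.
  refine tendsto_of_subseq_tendsto fun ns hns => ?_
  have hlim' : TendstoInMeasure μ (fun n => aε (ns n)) atTop a := fun ε hε => (hlim ε hε).comp hns
  obtain ⟨ms, -, hms⟩ := hlim'.exists_seq_tendsto_ae
  refine ⟨ms, ?_⟩
  simp_rw [e]
  have h0 : Tendsto (fun n => ∫⁻ x, ‖(a x - aε (ns (ms n)) x) • g x‖ₑ ^ 2 ∂μ) atTop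
      (𝓝 (∫⁻ _, 0 ∂μ)) := by
    refine tendsto_lintegral_of_dominated_convergence'
      (fun x => ENNReal.ofReal C ^ 2 * ‖g x‖ₑ ^ 2) (fun n => ?_) (fun n => ?_) ?_ ?_
    · exact ((ha.sub (haε _)).smul (Lp.aestronglyMeasurable g)).enorm.pow_const 2
    · filter_upwards [hC (ns (ms n))] with x hx
      rw [enorm_smul, mul_pow]
      gcongr
      rw [← ofReal_norm]
      exact ENNReal.ofReal_le_ofReal hx
    · rw [lintegral_const_mul' _ _ (by finiteness)]
      exact ENNReal.mul_ne_top (by finiteness) hgfin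
    · filter_upwards [hms] with x hx
      have h1 : Tendsto (fun n => (a x - aε (ns (ms n)) x) • g x) atTop (𝓝 ((a x - a x) • g x)) :=
        (tendsto_const_nhds.sub hx).smul tendsto_const_nhds
      have h2 := (ENNReal.continuous_pow 2).tendsto _ |>.comp h1.enorm
      simpa [Function.comp_def] using h2
  have h1 := (ENNReal.continuous_rpow_const (y := 1 / 2)).tendsto _ |>.comp h0
  simpa [Function.comp_def] using h1

theorem integral_smul_inner_eq {a : α → ℝ} {M : Lp E 2 μ →L[ℝ] Lp E 2 μ}
    (hM : ∀ g, M g =ᵐ[μ] fun x => a x • g x) (f g : Lp E 2 μ) :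
    ∫ x, a x * ⟪f x, g x⟫ ∂μ = ⟪M f, g⟫ := by
  rw [L2.inner_def]
  refine integral_congr_ae ?_
  filter_upwards [hM f] with x hx
  rw [hx, real_inner_smul_left]

theorem inner_sub_smul_eq {a a' : α → ℝ} {C C' : ℝ} (ha : AEStronglyMeasurable a μ)
    (ha' : AEStronglyMeasurable a' μ) (hC : ∀ᵐ x ∂μ, ‖a x‖ ≤ C) (hC' : ∀ᵐ x ∂μ, ‖a' x‖ ≤ C')
    {M : Lp E 2 μ →L[ℝ] Lp E 2 μ} (hM : ∀ g, M g =ᵐ[μ] fun x => (a x - a' x) • g x)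
    (f g : Lp E 2 μ) :
    ⟪M f, g⟫ = (∫ x, a x * ⟪f x, g x⟫ ∂μ) - ∫ x, a' x * ⟪f x, g x⟫ ∂μ := by
  have hi : Integrable (fun x => ⟪f x, g x⟫) μ := L2.integrable_inner f g
  rw [← integral_smul_inner_eq hM, ← integral_sub (hi.bdd_mul ha hC) (hi.bdd_mul ha' hC')]
  simp_rw [sub_mul]

theorem integral_mul_inner_real (b : α → ℝ) (f g : α → ℝ) :
    ∫ x, b x * ⟪f x, g x⟫ ∂μ = ∫ x, b x * f x * g x ∂μ := by
  simp only [RCLike.inner_apply, conj_trivial, mul_assoc, mul_comm (g _)]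

theorem mul_norm_sq_le_integral_smul_inner {a : α → ℝ} {c C : ℝ} (ha : AEStronglyMeasurable a μ)
    (hc : ∀ᵐ x ∂μ, c ≤ a x) (hC : ∀ᵐ x ∂μ, ‖a x‖ ≤ C) (f : Lp E 2 μ) :
    c * ‖f‖ ^ 2 ≤ ∫ x, a x * ⟪f x, f x⟫ ∂μ := by
  have hi : Integrable (fun x => ⟪f x, f x⟫) μ := L2.integrable_inner f f
  rw [← real_inner_self_eq_norm_sq, L2.inner_def, ← integral_const_mul]
  refine integral_mono_ae (hi.const_mul c) (hi.bdd_mul ha hC) ?_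
  filter_upwards [hc] with x hx
  gcongr
  exact real_inner_self_nonneg

end Multiplication

section Sobolev

variable {Ω : Set Plane}

/-- Each test function and direction in the definition of the weak gradient imposes a continuous
linear condition, so `H¹(Ω)` is closed in `L² × L²`. -/
theorem isClosed_H1 : IsClosed (H1 Ω : Set (WithLp 2 (Lp ℝ 2 (vol Ω) × Lp Plane 2 (vol Ω)))) := by
  have : (H1 Ω : Set (WithLp 2 (Lp ℝ 2 (vol Ω) × Lp Plane 2 (vol Ω)))) =
      ⋂ (φ : Plane → ℝ) (_ : ContDiff ℝ ∞ φ) (_ : HasCompactSupport φ) (_ : tsupport φ ⊆ Ω)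
        (e : Plane), {p | ∫ x in Ω, p.fst x * fderiv ℝ φ x e = -∫ x in Ω, ⟪p.snd x, e⟫ * φ x} := by
    ext p
    simp only [Set.mem_iInter]
    rfl
  rw [this]
  refine isClosed_iInter fun φ => isClosed_iInter fun hφ => isClosed_iInter fun hc =>
    isClosed_iInter fun _ => isClosed_iInter fun e => ?_
  have hd : MemLp (fun x => fderiv ℝ φ x e) 2 (vol Ω) :=
    ((hφ.continuous_fderiv (by simp)).clm_apply continuous_const).memLp_of_hasCompactSupport
      (hc.fderiv_apply (𝕜 := ℝ) e)
  have hm : MemLp (fun x => φ x • e) 2 (vol Ω) :=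
    (hφ.continuous.smul continuous_const).memLp_of_hasCompactSupport hc.smul_right
  have e1 : ∀ u : Lp ℝ 2 (vol Ω), ∫ x in Ω, u x * fderiv ℝ φ x e = ⟪hd.toLp _, u⟫ := fun u => by
    rw [L2.inner_def]
    refine integral_congr_ae ?_
    filter_upwards [hd.coeFn_toLp] with x hx
    rw [hx]; simp
  have e2 : ∀ G : Lp Plane 2 (vol Ω), ∫ x in Ω, ⟪G x, e⟫ * φ x = ⟪hm.toLp _, G⟫ := fun G => by
    rw [L2.inner_def]
    refine integral_congr_ae ?_
    filter_upwards [hm.coeFn_toLp] with x hx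
    rw [hx, real_inner_smul_left, real_inner_comm, mul_comm]
  simp_rw [e1, e2]
  refine isClosed_eq ?_ ?_
  · exact continuous_const.inner (WithLp.prod_continuous_ofLp 2 _ _).fst
  · exact (continuous_const.inner (WithLp.prod_continuous_ofLp 2 _ _).snd).neg

instance : CompleteSpace (H1 Ω) := isClosed_H1.completeSpace_coe

/-- The function underlying an element of `H¹(Ω)`, as a bounded operator. -/
noncomputable def fnL : H1 Ω →L[ℝ] Lp ℝ 2 (vol Ω) :=
  (WithLp.fstL 2 ℝ (Lp ℝ 2 (vol Ω)) (Lp Plane 2 (vol Ω))).comp (H1 Ω).subtypeL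

/-- The weak gradient as a bounded operator. -/
noncomputable def wgradL : H1 Ω →L[ℝ] Lp Plane 2 (vol Ω) :=
  (WithLp.sndL 2 ℝ (Lp ℝ 2 (vol Ω)) (Lp Plane 2 (vol Ω))).comp (H1 Ω).subtypeL

end Sobolev

/-! ### The bilinear form on the Hilbert space of solutions -/

section Form

/-- The bounded bilinear form `(p, q) ↦ ⟪A p, D q⟫`. -/
noncomputable def innerForm {V E : Type*} [NormedAddCommGroup V] [NormedSpace ℝ V]
    [NormedAddCommGroup E] [InnerProductSpace ℝ E] (A D : V →L[ℝ] E) : V →L[ℝ] V →L[ℝ] ℝ :=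
  (isBoundedBilinearMap_inner (𝕜 := ℝ)).toContinuousLinearMap.bilinearComp A D

theorem exists_continuousLinearMap_eq_sum_inner {V E E' ι : Type*} {G : ι → Type*} [Fintype ι]
    [NormedAddCommGroup V] [NormedSpace ℝ V] [NormedAddCommGroup E] [InnerProductSpace ℝ E]
    [NormedAddCommGroup E'] [InnerProductSpace ℝ E'] [∀ i, NormedAddCommGroup (G i)]
    [∀ i, InnerProductSpace ℝ (G i)] (A D : V →L[ℝ] E) (A' D' : V →L[ℝ] E')
    (Q : ∀ i, V →L[ℝ] G i) (c : ℝ) :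
    ∃ B : V →L[ℝ] V →L[ℝ] ℝ, ∀ p q,
      B p q = ⟪A p, D q⟫ + ⟪A' p, D' q⟫ + ∑ i, c * ⟪Q i p, Q i q⟫ := by
  refine ⟨innerForm A D + innerForm A' D' + ∑ i, c • innerForm (Q i) (Q i), fun p q => ?_⟩
  simp only [add_apply, sum_apply, smul_apply, smul_eq_mul]
  rfl

variable {Ω : Set Plane} {L : ℕ}

/-- The solution space `H¹(Ω) ⊕ ℝ^L` with its Hilbert space structure. -/
abbrev HilbertSol (Ω : Set Plane) (L : ℕ) : Type := WithLp 2 (H1 Ω × EuclideanSpace ℝ (Fin L))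

/-- The voltage drop `u - Uₗ` across the contact of the electrode `Oₗ`, for a trace operator `T`. -/
noncomputable def voltageDrop [IsFiniteMeasure (surf Ω)] (T : H1 Ω →L[ℝ] Lp ℝ 2 (surf Ω))
    (O : Fin L → Set Plane) (l : Fin L) :
    HilbertSol Ω L →L[ℝ] Lp ℝ 2 ((surf Ω).restrict (O l)) :=
  ((LpToLpRestrictCLM Plane ℝ ℝ (surf Ω) 2 (O l)).comp T).comp (WithLp.fstL 2 ℝ _ _)
    - ((Lp.constL 2 ((surf Ω).restrict (O l)) ℝ).comp (EuclideanSpace.proj l)).comp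
        (WithLp.sndL 2 ℝ _ _)

theorem starNorm_nonneg (O : Fin L → Set Plane) (p : SolSpace Ω L) : 0 ≤ starNorm O p :=
  Real.sqrt_nonneg _

variable [IsFiniteMeasure (surf Ω)] {T : H1 Ω →L[ℝ] Lp ℝ 2 (surf Ω)} {O : Fin L → Set Plane}

theorem voltageDrop_apply (l : Fin L) (p : HilbertSol Ω L) :
    voltageDrop T O l p = LpToLpRestrictCLM Plane ℝ ℝ (surf Ω) 2 (O l) (T p.fst)
      - Lp.const 2 ((surf Ω).restrict (O l)) (p.snd l) := rfl

theorem coeFn_voltageDrop (l : Fin L) (p : HilbertSol Ω L) :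
    voltageDrop T O l p =ᵐ[(surf Ω).restrict (O l)] fun x => T p.fst x - p.snd l := by
  rw [voltageDrop_apply]
  filter_upwards [Lp.coeFn_sub (LpToLpRestrictCLM Plane ℝ ℝ (surf Ω) 2 (O l) (T p.fst))
      (Lp.const 2 ((surf Ω).restrict (O l)) (p.snd l)),
    LpToLpRestrictCLM_coeFn ℝ (O l) (T p.fst),
    Lp.coeFn_const (p := 2) (μ := (surf Ω).restrict (O l)) (c := p.snd l)] with x h1 h2 h3
  rw [h1, Pi.sub_apply, h2, h3, Function.const_apply]

theorem integral_mul_eq_inner {α : Type*} [MeasurableSpace α] {μ : Measure α} {f g : Lp ℝ 2 μ}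
    {f' g' : α → ℝ} (hf : f =ᵐ[μ] f') (hg : g =ᵐ[μ] g') : ∫ x, f' x * g' x ∂μ = ⟪f, g⟫ := by
  rw [L2.inner_def]
  refine integral_congr_ae ?_
  filter_upwards [hf, hg] with x h1 h2
  rw [h1, h2, RCLike.inner_apply, conj_trivial, mul_comm]

theorem integral_voltageDrop_mul (hT : ∀ u, T u = trace u) (l : Fin L) (p q : HilbertSol Ω L) :
    ∫ x in O l, (trace p.fst x - p.snd l) * (trace q.fst x - q.snd l) ∂(surf Ω)
      = ⟪voltageDrop T O l p, voltageDrop T O l q⟫ := by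
  have hp := coeFn_voltageDrop (T := T) (O := O) l p
  have hq := coeFn_voltageDrop (T := T) (O := O) l q
  rw [hT] at hp hq
  exact integral_mul_eq_inner hp hq

theorem starNorm_sq (hT : ∀ u, T u = trace u) (p : HilbertSol Ω L) :
    starNorm O (WithLp.ofLp p) ^ 2 = ‖p.fst‖ ^ 2 + ∑ l, ‖voltageDrop T O l p‖ ^ 2 := by
  have h : ∀ l, ∫ x in O l, |trace p.fst x - p.snd l| ^ 2 ∂(surf Ω)
      = ‖voltageDrop T O l p‖ ^ 2 := fun l => by
    rw [← real_inner_self_eq_norm_sq, ← integral_voltageDrop_mul hT]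
    simp_rw [sq_abs, sq]
  rw [← Finset.sum_congr rfl fun l _ => h l, starNorm]
  exact Real.sq_sqrt (by positivity)

theorem norm_fst_le_starNorm (hT : ∀ u, T u = trace u) (p : HilbertSol Ω L) :
    ‖p.fst‖ ≤ starNorm O (WithLp.ofLp p) := by
  refine abs_le_of_sq_le_sq' ?_ (starNorm_nonneg O _) |>.2
  rw [starNorm_sq hT]
  exact le_add_of_nonneg_right (by positivity)

set_option maxHeartbeats 2000000 in
/-- For bounded coefficients, `bilin` is a bounded bilinear form on the Hilbert space
`HilbertSol Ω L`. -/
theorem exists_bilinL (hT : ∀ u, T u = trace u) {a b : Plane → ℝ}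
    (ha : AEStronglyMeasurable a (vol Ω)) (hb : AEStronglyMeasurable b (vol Ω)) {C : ℝ}
    (haC : ∀ᵐ x ∂(vol Ω), ‖a x‖ ≤ C) (hbC : ∀ᵐ x ∂(vol Ω), ‖b x‖ ≤ C) :
    ∃ B : HilbertSol Ω L →L[ℝ] HilbertSol Ω L →L[ℝ] ℝ, ∀ p q,
      B p q = bilin O a b (WithLp.ofLp p) (WithLp.ofLp q) := by
  obtain ⟨M, hM⟩ := exists_mulCLM (E := Plane) ha haC
  obtain ⟨N, hN⟩ := exists_mulCLM (E := ℝ) hb hbC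
  let fst := WithLp.fstL 2 ℝ (H1 Ω) (EuclideanSpace ℝ (Fin L))
  let A : HilbertSol Ω L →L[ℝ] Lp Plane 2 (vol Ω) := wgradL.comp fst
  let A' : HilbertSol Ω L →L[ℝ] Lp ℝ 2 (vol Ω) := fnL.comp fst
  obtain ⟨B, hB⟩ := exists_continuousLinearMap_eq_sum_inner (M.comp A) A (N.comp A') A'
    (voltageDrop T O) (1 / 2)
  refine ⟨B, fun p q => ?_⟩
  have e1 := integral_smul_inner_eq hM (wgrad p.fst) (wgrad q.fst)
  have e2 : ∫ x in Ω, b x * fn p.fst x * fn q.fst x = ⟪N (fn p.fst), fn q.fst⟫ := by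
    rw [← integral_smul_inner_eq hN, integral_mul_inner_real]
  have e3 := fun l => integral_voltageDrop_mul (O := O) hT l p q
  have e : bilin O a b (WithLp.ofLp p) (WithLp.ofLp q) =
      ⟪M (wgrad p.fst), wgrad q.fst⟫ + ⟪N (fn p.fst), fn q.fst⟫
        + ∑ l, (1 / 2 : ℝ) * ⟪voltageDrop T O l p, voltageDrop T O l q⟫ := by
    rw [← e1, ← e2, ← Finset.sum_congr rfl fun l _ => congrArg ((1 / 2 : ℝ) * ·) (e3 l)]
    rfl
  rw [e]
  exact hB p q

/-- Coercivity of the form with respect to `starNorm`. -/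
theorem min_mul_starNorm_sq_le_bilin (hT : ∀ u, T u = trace u) {a b : Plane → ℝ} {c C : ℝ}
    (ha : AEStronglyMeasurable a (vol Ω)) (hb : AEStronglyMeasurable b (vol Ω))
    (hac : ∀ᵐ x ∂(vol Ω), c ≤ a x) (hbc : ∀ᵐ x ∂(vol Ω), c ≤ b x)
    (haC : ∀ᵐ x ∂(vol Ω), ‖a x‖ ≤ C) (hbC : ∀ᵐ x ∂(vol Ω), ‖b x‖ ≤ C) (p : HilbertSol Ω L) :
    min c (1 / 2) * starNorm O (WithLp.ofLp p) ^ 2 ≤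
      bilin O a b (WithLp.ofLp p) (WithLp.ofLp p) := by
  have h1 := mul_norm_sq_le_integral_smul_inner ha hac haC (wgrad p.fst)
  have h2 := mul_norm_sq_le_integral_smul_inner hb hbc hbC (fn p.fst)
  rw [integral_mul_inner_real] at h2
  have h3 : ∑ l, (1 / 2 : ℝ) * ‖voltageDrop T O l p‖ ^ 2 = ∑ l, (1 / 2 : ℝ) *
      ∫ x in O l, (trace p.fst x - p.snd l) * (trace p.fst x - p.snd l) ∂(surf Ω) :=
    Finset.sum_congr rfl fun l _ => by
      rw [integral_voltageDrop_mul hT, real_inner_self_eq_norm_sq]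
  have e : bilin O a b (WithLp.ofLp p) (WithLp.ofLp p) =
      (∫ x in Ω, a x * ⟪wgrad p.fst x, wgrad p.fst x⟫)
      + (∫ x in Ω, b x * fn p.fst x * fn p.fst x)
      + ∑ l, (1 / 2 : ℝ) * ‖voltageDrop T O l p‖ ^ 2 := by
    rw [h3]; rfl
  rw [e, starNorm_sq hT, norm_sq_eq, ← Finset.mul_sum]
  set s := ∑ l, ‖voltageDrop T O l p‖ ^ 2
  have hs : 0 ≤ s := by positivity
  have m1 : min c (1 / 2) * ‖fn p.fst‖ ^ 2 ≤ c * ‖fn p.fst‖ ^ 2 := by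
    gcongr; exact min_le_left _ _
  have m2 : min c (1 / 2) * ‖wgrad p.fst‖ ^ 2 ≤ c * ‖wgrad p.fst‖ ^ 2 := by
    gcongr; exact min_le_left _ _
  have m3 : min c (1 / 2) * s ≤ 1 / 2 * s := by
    gcongr; exact min_le_right _ _
  linarith

/-- `starNorm` dominates the Hilbert space norm: `Uₗ` is the difference of the trace of `u` and the
voltage drop, and constants are controlled by their `L²(Oₗ)` norm because `|Oₗ| > 0`. -/
theorem exists_norm_le_starNorm (hT : ∀ u, T u = trace u) (hO : ∀ l, 0 < surf Ω (O l)) :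
    ∃ c, 0 < c ∧ ∀ p : HilbertSol Ω L, ‖p‖ ≤ c * starNorm O (WithLp.ofLp p) := by
  have hm : ∀ l, 0 < ((surf Ω).restrict (O l)).real Set.univ := fun l => by
    rw [measureReal_def, Measure.restrict_apply_univ]
    exact ENNReal.toReal_pos (hO l).ne' (measure_ne_top _ _)
  set m : Fin L → ℝ := fun l => ((surf Ω).restrict (O l)).real Set.univ ^ (1 / (2 : ℝ)) with hmdef
  have hm' : ∀ l, 0 < m l := fun l => Real.rpow_pos_of_pos (hm l) _
  set Q : Fin L → ℝ := fun l =>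
    ‖(LpToLpRestrictCLM Plane ℝ ℝ (surf Ω) 2 (O l)).comp T‖ with hQ
  have hU : ∀ (p : HilbertSol Ω L) l,
      |p.snd l| ≤ (Q l + 1) / m l * starNorm O (WithLp.ofLp p) := by
    intro p l
    have h1 : ‖Lp.const 2 ((surf Ω).restrict (O l)) (p.snd l)‖ = |p.snd l| * m l := by
      have := Lp.norm_const' (p := 2) (μ := (surf Ω).restrict (O l)) (c := p.snd l) (by norm_num)
        (by norm_num)
      simpa [hmdef] using this
    have h2 : Lp.const 2 ((surf Ω).restrict (O l)) (p.snd l) =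
        (LpToLpRestrictCLM Plane ℝ ℝ (surf Ω) 2 (O l)).comp T p.fst - voltageDrop T O l p := by
      rw [voltageDrop_apply]; simp
    have h3 : ‖voltageDrop T O l p‖ ≤ starNorm O (WithLp.ofLp p) := by
      refine abs_le_of_sq_le_sq' ?_ (starNorm_nonneg O _) |>.2
      rw [starNorm_sq hT]
      have := Finset.single_le_sum (f := fun l => ‖voltageDrop T O l p‖ ^ 2)
        (fun i _ => by positivity) (Finset.mem_univ l)
      have := sq_nonneg ‖p.fst‖
      linarith
    have h4 : |p.snd l| * m l ≤ (Q l + 1) * starNorm O (WithLp.ofLp p) := by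
      rw [← h1, h2]
      refine (norm_sub_le _ _).trans ?_
      have h5 := ContinuousLinearMap.le_opNorm
        ((LpToLpRestrictCLM Plane ℝ ℝ (surf Ω) 2 (O l)).comp T) p.fst
      have h6 : Q l * ‖p.fst‖ ≤ Q l * starNorm O (WithLp.ofLp p) := by
        have := norm_fst_le_starNorm (O := O) hT p
        have : 0 ≤ Q l := 
          norm_nonneg ((LpToLpRestrictCLM Plane ℝ ℝ (surf Ω) 2 (O l)).comp T)
        gcongr
      linarith
    rw [div_mul_eq_mul_div, le_div_iff₀ (hm' l)]
    exact h4
  refine ⟨Real.sqrt (1 + ∑ l, ((Q l + 1) / m l) ^ 2), by positivity, fun p => ?_⟩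
  have hS := starNorm_nonneg O (WithLp.ofLp p)
  refine abs_le_of_sq_le_sq' ?_ (by positivity) |>.2
  rw [mul_pow, Real.sq_sqrt (by positivity), WithLp.prod_norm_sq_eq_of_L2, add_mul, one_mul,
    EuclideanSpace.norm_sq_eq, Finset.sum_mul]
  gcongr with l
  · exact norm_fst_le_starNorm hT p
  · rw [← mul_pow]
    gcongr
    exact hU p l

end Form

/-! ### Well-posedness and stability -/

section WellPosed

variable {Ω : Set Plane} {L : ℕ} {O : Fin L → Set Plane} {cm cM : ℝ}

theorem Admissible.ae_le {a : Plane → ℝ} (hopen : IsOpen Ω) (ha : a ∈ Admissible Ω cm cM) :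
    ∀ᵐ x ∂(vol Ω), cm ≤ a x := by
  filter_upwards [ae_restrict_mem hopen.measurableSet] with x hx using (ha.2.2 x hx).1.le

theorem Admissible.ae_norm_le {a : Plane → ℝ} (hopen : IsOpen Ω) (hcm : 0 < cm)
    (ha : a ∈ Admissible Ω cm cM) : ∀ᵐ x ∂(vol Ω), ‖a x‖ ≤ cM := by
  filter_upwards [ae_restrict_mem hopen.measurableSet] with x hx
  rw [Real.norm_of_nonneg (hcm.trans (ha.2.2 x hx).1).le]
  exact (ha.2.2 x hx).2.le

theorem Admissible.ae_norm_sub_le {a a' : Plane → ℝ} (hopen : IsOpen Ω)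
    (ha : a ∈ Admissible Ω cm cM) (ha' : a' ∈ Admissible Ω cm cM) :
    ∀ᵐ x ∂(vol Ω), ‖a x - a' x‖ ≤ cM - cm := by
  filter_upwards [ae_restrict_mem hopen.measurableSet] with x hx
  have h1 := ha.2.2 x hx
  have h2 := ha'.2.2 x hx
  rw [Real.norm_eq_abs, abs_le]
  constructor <;> linarith

variable [IsFiniteMeasure (surf Ω)] {T : H1 Ω →L[ℝ] Lp ℝ 2 (surf Ω)}

/-- Existence and uniqueness of the weak solution, from the Lax–Milgram theorem. -/
theorem existsUnique_isWeakSolution (hopen : IsOpen Ω) (hT : ∀ u, T u = trace u)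
    (hO : ∀ l, 0 < surf Ω (O l)) (F : Fin L → ℝ) (hcm : 0 < cm) {a b : Plane → ℝ}
    (ha : a ∈ Admissible Ω cm cM) (hb : b ∈ Admissible Ω cm cM) :
    ∃! p : SolSpace Ω L, IsWeakSolution O F a b p := by
  have haC := Admissible.ae_norm_le hopen hcm ha
  have hbC := Admissible.ae_norm_le hopen hcm hb
  obtain ⟨B, hB⟩ := exists_bilinL (O := O) (L := L) hT ha.1 hb.1 haC hbC
  obtain ⟨c, hc, hle⟩ := exists_norm_le_starNorm (O := O) hT hO
  have hκ : 0 < min cm (1 / 2) := lt_min hcm (by norm_num)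
  have hcoer : IsCoercive B := by
    refine ⟨min cm (1 / 2) / c ^ 2, by positivity, fun p => ?_⟩
    have h1 := min_mul_starNorm_sq_le_bilin (O := O) hT ha.1 hb.1 (Admissible.ae_le hopen ha)
      (Admissible.ae_le hopen hb) haC hbC p
    rw [hB]
    refine le_trans ?_ h1
    rw [mul_assoc, ← sq, div_mul_eq_mul_div, div_le_iff₀ (by positivity), mul_assoc, ← mul_pow,
      mul_comm _ c]
    gcongr
    exact hle p
  -- The Riesz representative of the functional `(v, V) ↦ -∑ Fₗ Vₗ`.
  let f : HilbertSol Ω L := WithLp.toLp 2 (0, WithLp.toLp 2 fun l => -F l)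
  have hf : ∀ q : HilbertSol Ω L, ⟪f, q⟫ = -∑ l, F l * q.snd l := fun q => by
    rw [WithLp.prod_inner_apply, PiLp.inner_apply]
    simp [f, mul_comm]
  let S := hcoer.continuousLinearEquivOfBilin
  have hS : ∀ p q, ⟪S p, q⟫ = B p q := hcoer.continuousLinearEquivOfBilin_apply
  refine ⟨WithLp.ofLp (S.symm f), fun q => ?_, fun p hp => ?_⟩
  · have h1 := hS (S.symm f) (WithLp.toLp 2 q)
    rw [S.apply_symm_apply, hf, hB] at h1
    exact h1.symm
  · have h1 : S (WithLp.toLp 2 p) = f := by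
      refine ext_inner_right ℝ fun q => ?_
      rw [hS, hB, hf]
      exact hp (WithLp.ofLp q)
    rw [← h1, S.symm_apply_apply]

/-- Stability estimate: testing the difference of the two weak formulations with the difference of
the solutions bounds the latter by the consistency error. -/
theorem starNorm_sub_le (hopen : IsOpen Ω) (hT : ∀ u, T u = trace u)
    (F : Fin L → ℝ) (hcm : 0 < cm) {a b a' b' : Plane → ℝ}
    (ha : a ∈ Admissible Ω cm cM) (hb : b ∈ Admissible Ω cm cM)
    (ha' : a' ∈ Admissible Ω cm cM) (hb' : b' ∈ Admissible Ω cm cM) {p p' : SolSpace Ω L}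
    (hp : IsWeakSolution O F a b p) (hp' : IsWeakSolution O F a' b' p') :
    min cm (1 / 2) * starNorm O (p' - p) ≤
      (eLpNorm (fun x => (a x - a' x) • wgrad p.1 x) 2 (vol Ω)).toReal
        + (eLpNorm (fun x => (b x - b' x) • fn p.1 x) 2 (vol Ω)).toReal := by
  have haC := Admissible.ae_norm_le hopen hcm ha
  have hbC := Admissible.ae_norm_le hopen hcm hb
  have haC' := Admissible.ae_norm_le hopen hcm ha'
  have hbC' := Admissible.ae_norm_le hopen hcm hb'
  obtain ⟨B', hB'⟩ := exists_bilinL (O := O) (L := L) hT ha'.1 hb'.1 haC' hbC'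
  obtain ⟨M, hM⟩ := exists_mulCLM (E := Plane) (ha.1.sub ha'.1)
    (Admissible.ae_norm_sub_le hopen ha ha')
  obtain ⟨N, hN⟩ := exists_mulCLM (E := ℝ) (hb.1.sub hb'.1)
    (Admissible.ae_norm_sub_le hopen hb hb')
  set d : SolSpace Ω L := p' - p with hd
  have h1 := min_mul_starNorm_sq_le_bilin (O := O) hT ha'.1 hb'.1 (Admissible.ae_le hopen ha')
      (Admissible.ae_le hopen hb') haC' hbC' (WithLp.toLp 2 d)
  have h2 : bilin O a' b' d d = bilin O a b p d - bilin O a' b' p d := by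
    have e : bilin O a' b' d d = bilin O a' b' p' d - bilin O a' b' p d := by
      have := hB' (WithLp.toLp 2 p' - WithLp.toLp 2 p) (WithLp.toLp 2 d)
      rw [map_sub, sub_apply, hB', hB'] at this
      exact this.symm
    rw [e, hp' d, hp d]
  have h3 : bilin O a b p d - bilin O a' b' p d
      = ⟪M (wgrad p.1), wgrad d.1⟫ + ⟪N (fn p.1), fn d.1⟫ := by
    rw [inner_sub_smul_eq ha.1 ha'.1 haC haC' hM, inner_sub_smul_eq hb.1 hb'.1 hbC hbC' hN,
      integral_mul_inner_real, integral_mul_inner_real, bilin, bilin]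
    ring
  have n1 : ‖M (wgrad p.1)‖
      = (eLpNorm (fun x => (a x - a' x) • wgrad p.1 x) 2 (vol Ω)).toReal := by
    rw [Lp.norm_def, eLpNorm_congr_ae (hM _)]; rfl
  have n2 : ‖N (fn p.1)‖
      = (eLpNorm (fun x => (b x - b' x) • fn p.1 x) 2 (vol Ω)).toReal := by
    rw [Lp.norm_def, eLpNorm_congr_ae (hN _)]; rfl
  rw [← n1, ← n2]
  have hs := starNorm_nonneg O d
  have hd1 : ‖d.1‖ ≤ starNorm O d := norm_fst_le_starNorm hT (WithLp.toLp 2 d)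
  have h4 : min cm (1 / 2) * starNorm O d ^ 2
      ≤ (‖M (wgrad p.1)‖ + ‖N (fn p.1)‖) * starNorm O d := by
    refine h1.trans (le_trans (le_of_eq (h2.trans h3)) ?_)
    have c1 := real_inner_le_norm (M (wgrad p.1)) (wgrad d.1)
    have c2 := real_inner_le_norm (N (fn p.1)) (fn d.1)
    have c3 : ‖M (wgrad p.1)‖ * ‖wgrad d.1‖ ≤ ‖M (wgrad p.1)‖ * starNorm O d := by
      gcongr; exact (norm_wgrad_le d.1).trans hd1
    have c4 : ‖N (fn p.1)‖ * ‖fn d.1‖ ≤ ‖N (fn p.1)‖ * starNorm O d := by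
      gcongr; exact (norm_fn_le d.1).trans hd1
    linarith
  rcases hs.eq_or_lt with h0 | h0
  · rw [← h0, mul_zero]; positivity
  · refine le_of_mul_le_mul_right ?_ h0
    rwa [mul_assoc, ← sq]

end WellPosed

end RobinElectrode

open RobinElectrode

theorem theorem3p6 (Ω : Set RobinElectrode.Plane) (hopen : IsOpen Ω)
    (hbdd : Bornology.IsBounded Ω) (hlip : RobinElectrode.HasLipschitzBoundary Ω)
    (L : ℕ) (O : Fin L → Set RobinElectrode.Plane) (hOsub : ∀ l, O l ⊆ frontier Ω)
    (hOmeas : ∀ l, MeasurableSet (O l)) (hOpos : ∀ l, 0 < RobinElectrode.surf Ω (O l))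
    (F : Fin L → ℝ) (cm cM : ℝ) (hcm : 0 < cm) :
    (∀ a ∈ RobinElectrode.Admissible Ω cm cM, ∀ b ∈ RobinElectrode.Admissible Ω cm cM,
      ∃! p : RobinElectrode.SolSpace Ω L, RobinElectrode.IsWeakSolution O F a b p) ∧
    ∀ (a b : RobinElectrode.Plane → ℝ) (aε bε : ℕ → RobinElectrode.Plane → ℝ),
      a ∈ RobinElectrode.Admissible Ω cm cM → b ∈ RobinElectrode.Admissible Ω cm cM →
      (∀ n, aε n ∈ RobinElectrode.Admissible Ω cm cM) →
      (∀ n, bε n ∈ RobinElectrode.Admissible Ω cm cM) →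
      TendstoInMeasure (RobinElectrode.vol Ω) aε atTop a →
      TendstoInMeasure (RobinElectrode.vol Ω) bε atTop b →
      Tendsto (fun n => RobinElectrode.starNorm O
          (RobinElectrode.solutionOperator Ω O F (aε n) (bε n)
            - RobinElectrode.solutionOperator Ω O F a b)) atTop (𝓝 0) ∧
      Tendsto (fun n =>
          ‖RobinElectrode.voltages (RobinElectrode.solutionOperator Ω O F (aε n) (bε n))
            - RobinElectrode.voltages (RobinElectrode.solutionOperator Ω O F a b)‖)
        atTop (𝓝 0) := by
  have := (hasTraceInequality_frontier hopen hbdd hlip).isFiniteMeasure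
  obtain ⟨T, hT⟩ := exists_traceCLM hopen hbdd hlip
  have hwell : ∀ a ∈ Admissible Ω cm cM, ∀ b ∈ Admissible Ω cm cM,
      ∃! p : SolSpace Ω L, IsWeakSolution O F a b p := fun a ha b hb =>
    existsUnique_isWeakSolution hopen hT hOpos F hcm ha hb
  refine ⟨hwell, fun a b aε bε ha hb haε hbε hlima hlimb => ?_⟩
  have hsol : ∀ a ∈ Admissible Ω cm cM, ∀ b ∈ Admissible Ω cm cM,
      IsWeakSolution O F a b (solutionOperator Ω O F a b) := fun a ha b hb =>
    Classical.epsilon_spec (hwell a ha b hb).exists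
  set p := solutionOperator Ω O F a b with hp
  have hκ : 0 < min cm (1 / 2) := lt_min hcm (by norm_num)
  have hA := tendsto_eLpNorm_sub_smul_of_tendstoInMeasure ha.1 (fun n => (haε n).1)
    (fun n => Admissible.ae_norm_sub_le hopen ha (haε n)) hlima (wgrad p.1)
  have hB := tendsto_eLpNorm_sub_smul_of_tendstoInMeasure hb.1 (fun n => (hbε n).1)
    (fun n => Admissible.ae_norm_sub_le hopen hb (hbε n)) hlimb (fn p.1)
  have hstar : Tendsto (fun n => starNorm O (solutionOperator Ω O F (aε n) (bε n) - p))
      atTop (𝓝 0) := by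
    have hsum := (((ENNReal.tendsto_toReal ENNReal.zero_ne_top).comp hA).add
      ((ENNReal.tendsto_toReal ENNReal.zero_ne_top).comp hB)).div_const (min cm (1 / 2))
    rw [ENNReal.toReal_zero, add_zero, zero_div] at hsum
    refine squeeze_zero (fun n => starNorm_nonneg O _) (fun n => ?_) hsum
    rw [le_div_iff₀ hκ, mul_comm]
    exact starNorm_sub_le hopen hT F hcm ha hb (haε n) (hbε n) (hsol a ha b hb)
      (hsol _ (haε n) _ (hbε n))
  refine ⟨hstar, ?_⟩
  obtain ⟨c, hc, hle⟩ := exists_norm_le_starNorm (O := O) hT hOpos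
  have hlim := hstar.const_mul c
  rw [mul_zero] at hlim
  refine squeeze_zero (fun n => norm_nonneg _) (fun n => ?_) hlim
  set q := solutionOperator Ω O F (aε n) (bε n) - p with hq
  have h1 : ‖q.2‖ ≤ ‖(WithLp.toLp 2 q : HilbertSol Ω L)‖ := WithLp.norm_snd_le _ (WithLp.toLp 2 q)
  exact h1.trans (hle (WithLp.toLp 2 q))
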